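/- Let $G$ and $H$ be countably infinite amenable discrete groups, neither of which is locally virtually cyclic; that is, each has a finitely generated subgroup that contains no cyclic (possibly finite) subgroup of finite index. Let $G\curvearrowright X$ and $H\curvearrowright Y$ be continuous actions on compact metrizable spaces which are topologically free, i.e. the points with trivial stabilizer are dense. Suppose the two actions are continuously orbit equivalent: there are a homeomorphism $\Phi:X\to Y$ and continuous maps $\kappa:G\times X\to H$ and $\lambda:H\times Y\to G$ with $$\Phi(sx)=\kappa(s,x)\,\Phi(x),\qquad \Phi^{-1}(ty)=\lambda(t,y)\,\Phi^{-1}(y)$$ for all $s\in G$, $x\in X$, $t\in H$, $y\in Y$. Then the two actions have the same topological entropy: $$h_{\mathrm{top}}(G\curvearrowright X)=h_{\mathrm{top}}(H\curvearrowright Y)\in[0,\infty].$$ Here a Følner sequence for $G$ is a sequence $(F_n)$ of nonempty finite subsets of $G$ with $|gF_n\,\triangle\,F_n|/|F_n|\to 0$ for every $g\in G$, and $$h_{\mathrm{top}}(G\curvearrowright X)=\sup_{\mathcal U}\ \limsup_{n\to\infty}\frac1{|F_n|}\log N\big(\mathcal U^{F_n}\big),$$ where $\mathcal U$ ranges over the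 finite open covers of $X$, $\mathcal U^{F}$ is the cover consisting of all sets $\bigcap_{s\in F}s^{-1}U_s$ with $U_s\in\mathcal U$, and $N(\cdot)$ is the minimum cardinality of a subcover (the $\limsup$ is in fact a limit, and the value does not depend on the Følner sequence); similarly for $H\curvearrowright Y$. The equality holds for every choice of Følner sequences of $G$ and of $H$ used to compute the two entropies. -/

import Mathlib

open Filter Topology MeasureTheory
open scoped ENNReal Pointwise

noncomputable section

namespace OrbitEntropy

/-- A group is amenable (as a discrete group) if it carries a left-invariant mean: a finitely
additive probability measure defined on all subsets and invariant under left translation. -/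
def IsAmenable (G : Type*) [Group G] : Prop :=
  ∃ m : Set G → ℝ≥0∞, m Set.univ = 1 ∧
    (∀ s t : Set G, Disjoint s t → m (s ∪ t) = m s + m t) ∧
    ∀ (g : G) (s : Set G), m (g • s) = m s

/-- A group is virtually cyclic if it has a cyclic subgroup of finite index
(in particular every finite group is virtually cyclic). -/
def IsVirtuallyCyclic (G : Type*) [Group G] : Prop :=
  ∃ C : Subgroup G, IsCyclic C ∧ C.FiniteIndex

/-- Every finitely generated subgroup is virtually cyclic. -/
def IsLocallyVirtuallyCyclic (G : Type*) [Group G] : Prop :=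
  ∀ K : Subgroup G, K.FG → IsVirtuallyCyclic K

/-- The points with trivial stabilizer are dense. -/
def IsTopologicallyFree (G X : Type*) [Group G] [TopologicalSpace X] [MulAction G X] : Prop :=
  Dense {x : X | MulAction.stabilizer G x = ⊥}

/-- Continuous orbit equivalence of the actions of `G` on `X` and of `H` on `Y`. -/
def ContinuouslyOrbitEquivalent (G X H Y : Type*)
    [Group G] [TopologicalSpace G] [TopologicalSpace X] [MulAction G X]
    [Group H] [TopologicalSpace H] [TopologicalSpace Y] [MulAction H Y] : Prop :=
  ∃ (Φ : X ≃ₜ Y) (κ : G × X → H) (l : H × Y → G),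
    Continuous κ ∧ Continuous l ∧
    (∀ (s : G) (x : X), Φ (s • x) = κ (s, x) • Φ x) ∧
    (∀ (t : H) (y : Y), Φ.symm (t • y) = l (t, y) • Φ.symm y)

/-- A (left) Følner sequence of finite subsets of the discrete group `G`: the sets are eventually
nonempty and `|g F n ∆ F n| / |F n| → 0` for every `g`. This is the Mathlib notion for the
left translation action of `G` on itself and the counting measure. -/
def IsFolnerSeq {G : Type*} [Group G] (F : ℕ → Finset G) : Prop :=
  letI : MeasurableSpace G := ⊤
  IsFoelner G (Measure.count : Measure G) atTop (fun n ↦ (F n : Set G))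

/-- Finite open covers of `X`. -/
structure IsFiniteOpenCover {X : Type*} [TopologicalSpace X] (𝒰 : Set (Set X)) : Prop where
  finite : 𝒰.Finite
  isOpen : ∀ U ∈ 𝒰, IsOpen U
  cover : ⋃₀ 𝒰 = Set.univ

/-- `N(𝒰)`, the minimum cardinality of a (finite) subcover of `𝒰`. -/
def minSubcover {X : Type*} (𝒰 : Set (Set X)) : ℕ :=
  sInf {n : ℕ | ∃ 𝒱 ⊆ 𝒰, 𝒱.Finite ∧ ⋃₀ 𝒱 = Set.univ ∧ 𝒱.ncard = n}

/-- The join `𝒰^F = ⋁_{s ∈ F} s⁻¹ 𝒰`: all sets `⋂_{s ∈ F} s⁻¹ U_s` with `U_s ∈ 𝒰`. -/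
def coverJoin {G X : Type*} [Group G] [MulAction G X] (𝒰 : Set (Set X)) (F : Finset G) :
    Set (Set X) :=
  {W | ∃ U : G → Set X, (∀ s ∈ F, U s ∈ 𝒰) ∧ W = ⋂ s ∈ F, s⁻¹ • U s}

/-- The topological entropy of the action of `G` on `X`, computed along the sequence `F`
(meant for Følner sequences): the supremum over finite open covers `𝒰` of the exponential growth
rate of `N(𝒰^{F n})` relative to `|F n|`. -/
def topEntropy {G : Type*} (X : Type*) [Group G] [TopologicalSpace X] [MulAction G X]
    (F : ℕ → Finset G) : EReal :=
  ⨆ 𝒰 : {𝒰 : Set (Set X) // IsFiniteOpenCover 𝒰},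
    limsup (fun n : ℕ ↦
      ((Real.log (minSubcover (coverJoin 𝒰.1 (F n))) / ((F n).card : ℝ) : ℝ) : EReal)) atTop

end OrbitEntropy

end

/-!
By symmetry it suffices to show `h(H ↷ Y) ≤ h(G ↷ X)`. By the Ornstein–Weiss lemma this follows
once, for each finite open cover `𝒱` of `Y`, each `a > h(G ↷ X)` and each `η > 0`, there are
arbitrarily invariant finite sets `T ⊆ H` with `log N(𝒱^T) ≤ (a + η) #T`.

Topological freeness makes `κ` and `λ` cocycles, so that along the orbit of `x` the set `T`
corresponds to a set `T_x ⊆ G` of the same cardinality and of comparable invariance. The pullback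
of `𝒱` to `X`, refined by the level sets of the cocycles, grows along each `T_x` at rate at most
`a`. It remains to see that the number of sets `T_x` is subexponential in `#T`.

This is where a symmetric finite set `S` generating a subgroup that is not virtually cyclic enters:
its balls grow faster than linearly in the radius `r`, so a set of points of `T` with disjoint
`r`-balls has far fewer than `#T / r` points. Choose `T` connected for a large set of generators. It
has few `S`-components, each of which is sampled at one point and then along an `r`-separated net.
Each new sample of `λ` comes from an earlier one by a word of length `O(r)` in `S`, with one jump
by a larger generator for each new component, so all of them together take few bits per point of
`T`. Given the samples, `T_x` is determined by its edge boundary, which is small and lies in a set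
of size `O(#T)`.
-/

namespace OrbitEntropy

open scoped RightActions Finset

section Invariance

variable {G : Type*} [Group G] [DecidableEq G] {K K' F : Finset G} {δ δ' : ℝ}

/-- The boundary of `F` relative to `K`: the edges `(k, f)` of the left Cayley graph of `K` that
leave `F`. Its cardinality measures how far `F` is from being invariant under `K`. -/
def edgeBoundary (K F : Finset G) : Finset (G × G) := {p ∈ K ×ˢ F | p.1 * p.2 ∉ F}

lemma mem_edgeBoundary {p : G × G} :
    p ∈ edgeBoundary K F ↔ p.1 ∈ K ∧ p.2 ∈ F ∧ p.1 * p.2 ∉ F := by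
  simp [edgeBoundary, and_assoc]

@[simp] lemma edgeBoundary_empty_right (K : Finset G) : edgeBoundary K ∅ = ∅ := by
  simp [edgeBoundary]

lemma edgeBoundary_mono (h : K ⊆ K') (F : Finset G) : edgeBoundary K F ⊆ edgeBoundary K' F :=
  Finset.filter_subset_filter _ (Finset.product_subset_product_left h)

lemma card_edgeBoundary (K F : Finset G) : #(edgeBoundary K F) = ∑ k ∈ K, #{f ∈ F | k * f ∉ F} := by
  simp only [edgeBoundary, Finset.card_filter, Finset.sum_product]

lemma mem_op_smul_finset {T : Finset G} {c g : G} : g ∈ T <• c ↔ g * c⁻¹ ∈ T := by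
  simp [Finset.mem_smul_finset, ← eq_mul_inv_iff_mul_eq]

lemma card_edgeBoundary_op_smul (K F : Finset G) (c : G) :
    #(edgeBoundary K (F <• c)) = #(edgeBoundary K F) := by
  refine Finset.card_nbij' (fun p ↦ (p.1, p.2 * c⁻¹)) (fun p ↦ (p.1, p.2 * c)) ?_ ?_ ?_ ?_ <;>
    simp +contextual [Set.MapsTo, Set.LeftInvOn, mem_edgeBoundary, mem_op_smul_finset, mul_assoc]

lemma edgeBoundary_union_subset (K A B : Finset G) :
    edgeBoundary K (A ∪ B) ⊆ edgeBoundary K A ∪ edgeBoundary K B := by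
  intro p
  simp only [Finset.mem_union, mem_edgeBoundary]
  tauto

lemma card_filter_exists_mul_notMem_le (K F : Finset G) :
    #{f ∈ F | ∃ k ∈ K, k * f ∉ F} ≤ #(edgeBoundary K F) := by
  refine (Finset.card_le_card fun f ↦ ?_).trans (Finset.card_image_le (f := Prod.snd))
  simp only [Finset.mem_filter, Finset.mem_image, mem_edgeBoundary, Prod.exists, exists_eq_right]
  exact fun ⟨hf, k, hk, hkf⟩ ↦ ⟨k, hk, hf, hkf⟩

lemma card_filter_exists_mul_mem_le (K Z F : Finset G) :
    #{c ∈ F \ Z | ∃ k ∈ K, k * c ∈ Z} ≤ #(edgeBoundary K⁻¹ Z) := by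
  refine (Finset.card_le_card fun c ↦ ?_).trans
    (Finset.card_image_le (f := fun p : G × G ↦ p.1 * p.2))
  simp only [Finset.mem_filter, Finset.mem_sdiff, Finset.mem_image, mem_edgeBoundary, Prod.exists]
  rintro ⟨⟨-, hc⟩, k, hk, hkc⟩
  exact ⟨k⁻¹, k * c, ⟨Finset.inv_mem_inv hk, hkc, by simpa using hc⟩, by simp⟩

/-- `F` is `(K, δ)`-invariant: its boundary relative to `K` has at most `δ * #F` edges. -/
def IsInvariant (K : Finset G) (δ : ℝ) (F : Finset G) : Prop :=
  (#(edgeBoundary K F) : ℝ) ≤ δ * #F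

lemma IsInvariant.mono (h : IsInvariant K' δ F) (hK : K ⊆ K') (hδ : δ ≤ δ') :
    IsInvariant K δ' F :=
  calc (#(edgeBoundary K F) : ℝ) ≤ #(edgeBoundary K' F) := by
        gcongr
        exact edgeBoundary_mono hK F
    _ ≤ δ * #F := h
    _ ≤ δ' * #F := by gcongr

/-- The filter of nonempty finite sets that are more and more invariant under `K`. -/
def invariantFilter (K : Finset G) : Filter (Finset G) :=
  ⨅ δ > (0 : ℝ), 𝓟 {F | F.Nonempty ∧ IsInvariant K δ F}

variable (G) in
/-- The filter along which Følner sequences converge: nonempty finite sets that are more and more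
invariant under every finite set. It replaces the choice of a Følner sequence. -/
def folner : Filter (Finset G) := ⨅ K, invariantFilter K

lemma hasBasis_invariantFilter (K : Finset G) :
    (invariantFilter K).HasBasis (fun δ : ℝ ↦ 0 < δ) fun δ ↦ {F | F.Nonempty ∧ IsInvariant K δ F} :=
  hasBasis_biInf_principal'
    (fun δ hδ δ' hδ' ↦ ⟨min δ δ', lt_min hδ hδ',
      fun _ hF ↦ ⟨hF.1, hF.2.mono subset_rfl (min_le_left _ _)⟩,
      fun _ hF ↦ ⟨hF.1, hF.2.mono subset_rfl (min_le_right _ _)⟩⟩)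
    ⟨1, one_pos⟩

lemma eventually_isInvariant (K : Finset G) (hδ : 0 < δ) :
    ∀ᶠ F in invariantFilter K, IsInvariant K δ F :=
  (hasBasis_invariantFilter K).eventually_iff.2 ⟨δ, hδ, fun _ hF ↦ hF.2⟩

lemma eventually_nonempty_invariantFilter (K : Finset G) :
    ∀ᶠ F in invariantFilter K, F.Nonempty :=
  (hasBasis_invariantFilter K).eventually_iff.2 ⟨1, one_pos, fun _ hF ↦ hF.1⟩

lemma invariantFilter_anti : Antitone (invariantFilter (G := G)) := fun _ _ hK ↦
  iInf₂_mono fun _ _ ↦ principal_mono.2 fun _ hF ↦ ⟨hF.1, hF.2.mono hK le_rfl⟩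

lemma folner_le (K : Finset G) : folner G ≤ invariantFilter K := iInf_le _ K

lemma eventually_folner_iff {p : Finset G → Prop} :
    (∀ᶠ F in folner G, p F) ↔ ∃ K, ∀ᶠ F in invariantFilter K, p F :=
  mem_iInf_of_directed (invariantFilter_anti.directed_ge) _

lemma eventually_folner_isInvariant (K : Finset G) (hδ : 0 < δ) :
    ∀ᶠ F in folner G, IsInvariant K δ F :=
  folner_le K (eventually_isInvariant K hδ)

lemma IsFolnerSeq.tendsto_card_div {F : ℕ → Finset G} (hF : IsFolnerSeq F) (k : G) :
    Tendsto (fun n ↦ (#{f ∈ F n | k * f ∉ F n} : ℝ) / #(F n)) atTop (𝓝 0) := by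
  let _ : MeasurableSpace G := ⊤
  have : DiscreteMeasurableSpace G := ⟨fun _ ↦ trivial⟩
  have hle (n : ℕ) : (#{f ∈ F n | k * f ∉ F n} : ℝ≥0∞) / #(F n) ≤
      Measure.count (symmDiff (k • (F n : Set G)) (F n)) / Measure.count (F n : Set G) := by
    rw [Measure.count_apply_finset, ← Finset.card_smul_finset k, ← Measure.count_apply_finset]
    gcongr
    intro x hx
    obtain ⟨f, hf, rfl⟩ := Finset.mem_smul_finset.1 hx
    obtain ⟨hfF, hkf⟩ := Finset.mem_filter.1 hf
    exact Or.inl ⟨Set.smul_mem_smul_set hfF, hkf⟩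
  have hlim := tendsto_of_tendsto_of_tendsto_of_le_of_le tendsto_const_nhds
    (IsFoelner.tendsto_meas_smul_symmDiff hF k) (fun _ ↦ zero_le) hle
  simpa [Function.comp_def] using (ENNReal.tendsto_toReal ENNReal.zero_ne_top).comp hlim

omit [DecidableEq G] in
lemma IsFolnerSeq.eventually_nonempty {F : ℕ → Finset G} (hF : IsFolnerSeq F) :
    ∀ᶠ n in atTop, (F n).Nonempty := by
  let _ : MeasurableSpace G := ⊤
  filter_upwards [IsFoelner.eventually_meas_ne_zero hF] with n hn
  rw [Finset.nonempty_iff_ne_empty]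
  rintro h
  simp [h] at hn

lemma IsFolnerSeq.tendsto_folner {F : ℕ → Finset G} (hF : IsFolnerSeq F) :
    Tendsto F atTop (folner G) := by
  refine tendsto_iInf.2 fun K ↦ (hasBasis_invariantFilter K).tendsto_right_iff.2 fun δ hδ ↦ ?_
  have hlim : Tendsto (fun n ↦ (#(edgeBoundary K (F n)) : ℝ) / #(F n)) atTop (𝓝 0) := by
    simpa [card_edgeBoundary, Finset.sum_div] using
      tendsto_finsetSum K fun k _ ↦ hF.tendsto_card_div k
  filter_upwards [hF.eventually_nonempty, hlim.eventually_le_const hδ] with n hne hle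
  exact ⟨hne, (div_le_iff₀ (mod_cast hne.card_pos)).1 hle⟩

lemma IsFolnerSeq.neBot_folner {F : ℕ → Finset G} (hF : IsFolnerSeq F) : (folner G).NeBot :=
  hF.tendsto_folner.neBot

end Invariance

section OrnsteinWeiss

variable {G : Type*} [Group G] [DecidableEq G] {ψ : Finset G → ℝ} {T F Z Z₀ C W : Finset G}
  {a ε : ℝ}

/-- Nonnegative subadditive functions on the finite subsets of a group, invariant under right
translation: the functions to which the Ornstein–Weiss lemma applies. -/
structure IsSubadditiveInvariant (ψ : Finset G → ℝ) : Prop where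
  nonneg : ∀ A, 0 ≤ ψ A
  empty : ψ ∅ = 0
  union_le : ∀ A B, ψ (A ∪ B) ≤ ψ A + ψ B
  op_smul_le : ∀ A (c : G), ψ (A <• c) ≤ ψ A

lemma isSubadditiveInvariant_card_edgeBoundary (K : Finset G) :
    IsSubadditiveInvariant fun F ↦ (#(edgeBoundary K F) : ℝ) where
  nonneg _ := Nat.cast_nonneg _
  empty := by simp
  union_le A B := mod_cast
    (Finset.card_le_card (edgeBoundary_union_subset K A B)).trans (Finset.card_union_le _ _)
  op_smul_le A c := by rw [card_edgeBoundary_op_smul]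

namespace IsSubadditiveInvariant

lemma le_card_mul (h : IsSubadditiveInvariant ψ) (F : Finset G) : ψ F ≤ #F * ψ {1} := by
  induction F using Finset.induction_on with
  | empty => simp [h.empty]
  | insert g s hg ih =>
    have hunion := h.union_le {g} s
    have hsmul : ψ {g} ≤ ψ {1} := by simpa using h.op_smul_le {1} g
    rw [Finset.card_insert_of_notMem hg, Finset.insert_eq]
    push_cast
    linarith

lemma union_op_smul_le (h : IsSubadditiveInvariant ψ) (hT : T.Nonempty) (hψT : ψ T ≤ a * #T)
    (hε : ε < 1) {c : G} (hc : (#(T <• c ∩ Z) : ℝ) ≤ ε * #T) :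
    ψ (Z ∪ T <• c) ≤ ψ Z + a / (1 - ε) * (#(Z ∪ T <• c) - #Z) := by
  have ha : 0 ≤ a := nonneg_of_mul_nonneg_left ((h.nonneg T).trans hψT) (mod_cast hT.card_pos)
  have hcard : (#(Z ∪ T <• c) : ℝ) + #(T <• c ∩ Z) = #Z + #T := by
    rw [Finset.inter_comm, ← Finset.card_smul_finset (MulOpposite.op c) T]
    exact_mod_cast Finset.card_union_add_card_inter Z (T <• c)
  have hε' : 0 < 1 - ε := sub_pos.2 hε
  calc ψ (Z ∪ T <• c) ≤ ψ Z + a * #T := by linarith [h.union_le Z (T <• c), h.op_smul_le T c]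
    _ = ψ Z + a / (1 - ε) * ((1 - ε) * #T) := by field_simp
    _ ≤ ψ Z + a / (1 - ε) * (#(Z ∪ T <• c) - #Z) := by
        gcongr
        linarith

end IsSubadditiveInvariant

lemma exists_saturated_superset (hT : T.Nonempty) (hZ₀ : Z₀ ⊆ F) (hε : ε < 1) :
    ∃ Z, Z₀ ⊆ Z ∧ Z ⊆ F ∧
      (∀ ψ a, IsSubadditiveInvariant ψ → ψ T ≤ a * #T →
        ψ Z ≤ ψ Z₀ + a / (1 - ε) * (#Z - #Z₀)) ∧
      ∀ c : G, T <• c ⊆ F → ε * #T < #(T <• c ∩ Z) := by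
  classical
  let candidates := {Z ∈ F.powerset | Z₀ ⊆ Z ∧ ∀ ψ a, IsSubadditiveInvariant ψ →
    ψ T ≤ a * #T → ψ Z ≤ ψ Z₀ + a / (1 - ε) * (#Z - #Z₀)}
  obtain ⟨Z, hZ, hmax⟩ := Finset.exists_max_image candidates Finset.card
    ⟨Z₀, by simp [candidates, hZ₀]⟩
  simp only [candidates, Finset.mem_filter, Finset.mem_powerset] at hZ hmax
  obtain ⟨hZF, hZ₀Z, hψZ⟩ := hZ
  refine ⟨Z, hZ₀Z, hZF, hψZ, fun c hc ↦ ?_⟩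
  by_contra! hsmall
  have hle : #(Z ∪ T <• c) ≤ #Z := by
    refine hmax _ ⟨Finset.union_subset hZF hc, hZ₀Z.trans Finset.subset_union_left, ?_⟩
    intro ψ a hψ ha
    linarith [hψZ ψ a hψ ha, hψ.union_op_smul_le hT ha hε hsmall]
  have hsub : T <• c ∩ Z = T <• c := by
    rw [Finset.inter_eq_left, ← Finset.union_eq_left]
    exact (Finset.eq_of_subset_of_card_le Finset.subset_union_left hle).symm
  rw [hsub, Finset.card_smul_finset] at hsmall
  have : (0 : ℝ) < #T := mod_cast hT.card_pos
  nlinarith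

lemma sum_card_op_smul_inter_le (T C W : Finset G) : ∑ c ∈ C, #(T <• c ∩ W) ≤ #T * #W :=
  calc ∑ c ∈ C, #(T <• c ∩ W) = ∑ c ∈ C, #{t ∈ T | t * c ∈ W} := by
        refine Finset.sum_congr rfl fun c _ ↦ ?_
        rw [← Finset.card_smul_finset (MulOpposite.op c) {t ∈ T | t * c ∈ W}]
        congr 1
        ext g
        simp [mem_op_smul_finset]
    _ = ∑ t ∈ T, #{c ∈ C | t * c ∈ W} := Finset.sum_card_bipartiteAbove_eq_sum_card_bipartiteBelow _
    _ ≤ ∑ _t ∈ T, #W := Finset.sum_le_sum fun t _ ↦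
        Finset.card_le_card_of_injOn (t * ·) (fun c hc ↦ (Finset.mem_filter.1 hc).2)
          (mul_right_injective t).injOn
    _ = #T * #W := by simp

lemma mul_card_le_of_forall_le_card_inter (hT : T.Nonempty)
    (h : ∀ c ∈ C, ε * #T ≤ #(T <• c ∩ W)) : ε * #C ≤ #W := by
  have hT' : (0 : ℝ) < #T := mod_cast hT.card_pos
  refine le_of_mul_le_mul_left ?_ hT'
  calc #T * (ε * #C) = ∑ _c ∈ C, ε * #T := by simp; ring
    _ ≤ ∑ c ∈ C, (#(T <• c ∩ W) : ℝ) := Finset.sum_le_sum h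
    _ ≤ #T * #W := mod_cast sum_card_op_smul_inter_le T C W

lemma card_sdiff_le_card_translates_add (T F Z₀ : Finset G) :
    #(F \ Z₀) ≤ #{c ∈ F \ Z₀ | T <• c ⊆ F \ Z₀} + #(edgeBoundary T F) + #(edgeBoundary T⁻¹ Z₀) := by
  calc #(F \ Z₀) ≤ #({c ∈ F \ Z₀ | T <• c ⊆ F \ Z₀} ∪ {c ∈ F | ∃ t ∈ T, t * c ∉ F} ∪
        {c ∈ F \ Z₀ | ∃ t ∈ T, t * c ∈ Z₀}) := by
        refine Finset.card_le_card fun c hc ↦ ?_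
        have hsub : T <• c ⊆ F \ Z₀ ↔ ∀ t ∈ T, t * c ∈ F ∧ t * c ∉ Z₀ := by
          simp [Finset.subset_iff, Finset.mem_smul_finset]
        simp only [Finset.mem_union, Finset.mem_filter, hc, true_and, hsub,
          (Finset.mem_sdiff.1 hc).1]
        grind
    _ ≤ _ := by
        refine (Finset.card_union_le _ _).trans (add_le_add ((Finset.card_union_le _ _).trans ?_)
          (card_filter_exists_mul_mem_le T Z₀ F))
        exact add_le_add_right (card_filter_exists_mul_notMem_le T F) _

lemma card_sdiff_le_of_saturated (hT : T.Nonempty) (hε : 0 ≤ ε) (hZ₀Z : Z₀ ⊆ Z) (hZF : Z ⊆ F)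
    (hsat : ∀ c : G, T <• c ⊆ F → ε * #T < #(T <• c ∩ Z)) :
    (#(F \ Z) : ℝ) ≤
      (1 - ε) * #(F \ Z₀) + ε * (#(edgeBoundary T F) + #(edgeBoundary T⁻¹ Z₀)) := by
  have hadded : ε * #{c ∈ F \ Z₀ | T <• c ⊆ F \ Z₀} ≤ #(Z \ Z₀) := by
    refine mul_card_le_of_forall_le_card_inter hT fun c hc ↦ ?_
    have hc' := (Finset.mem_filter.1 hc).2
    refine (hsat c (hc'.trans Finset.sdiff_subset)).le.trans
      (Nat.cast_le.2 (Finset.card_le_card fun g hg ↦ ?_))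
    have := hc' (Finset.mem_inter.1 hg).1
    grind
  have hcount : (#(F \ Z₀) : ℝ) ≤ #{c ∈ F \ Z₀ | T <• c ⊆ F \ Z₀} +
      #(edgeBoundary T F) + #(edgeBoundary T⁻¹ Z₀) :=
    mod_cast card_sdiff_le_card_translates_add T F Z₀
  have hsplit : (#(F \ Z₀) : ℝ) = #(F \ Z) + #(Z \ Z₀) := by
    rw [Finset.cast_card_sdiff hZF, Finset.cast_card_sdiff hZ₀Z,
      Finset.cast_card_sdiff (hZ₀Z.trans hZF)]
    ring
  nlinarith [mul_le_mul_of_nonneg_left hcount hε]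

lemma IsSubadditiveInvariant.eventually_exists_quasiTiling (hψ : IsSubadditiveInvariant ψ)
    (hsup : ∃ᶠ T in folner G, ψ T ≤ a * #T) (hε₀ : 0 ≤ ε) (hε₁ : ε < 1) (k : ℕ) (K : Finset G)
    {δ : ℝ} (hδ : 0 < δ) :
    ∀ᶠ F in folner G, ∃ Z ⊆ F, ψ Z ≤ a / (1 - ε) * #Z ∧ IsInvariant K δ Z ∧
      (#(F \ Z) : ℝ) ≤ (1 - ε / 2) ^ k * #F := by
  induction k generalizing K δ with
  | zero =>
    exact Eventually.of_forall fun F ↦ ⟨∅, by simp, by simp [hψ.empty], by simp [IsInvariant]⟩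
  | succ k ih =>
    obtain ⟨T, hψT, hTK, hT⟩ := (hsup.and_eventually
      ((eventually_folner_isInvariant K (mul_pos hδ (sub_pos.2 hε₁))).and
        (folner_le K (eventually_nonempty_invariantFilter K)))).exists
    set ρ := (1 - ε / 2) ^ k with hρ
    have hρ₀ : 0 < ρ := pow_pos (by linarith) k
    filter_upwards [ih (K ∪ T⁻¹) (δ := min δ (ρ / 4)) (by positivity),
      eventually_folner_isInvariant T (δ := ρ / 4) (by positivity)]
      with F ⟨Z₀, hZ₀F, hψZ₀, hZ₀, hcard⟩ hFT
    obtain ⟨Z, hZ₀Z, hZF, hZ, hsat⟩ := exists_saturated_superset hT hZ₀F hε₁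
    refine ⟨Z, hZF, by linarith [hZ ψ a hψ hψT], ?_, ?_⟩
    · have hKZ := hZ _ _ (isSubadditiveInvariant_card_edgeBoundary K) hTK
      have hKZ₀ : IsInvariant K δ Z₀ := hZ₀.mono Finset.subset_union_left (min_le_left _ _)
      rw [mul_div_cancel_right₀ _ (sub_pos.2 hε₁).ne'] at hKZ
      unfold IsInvariant at hKZ₀ ⊢
      linarith
    · have hTZ₀ : (#(edgeBoundary T⁻¹ Z₀) : ℝ) ≤ ρ / 4 * #F :=
        (hZ₀.mono Finset.subset_union_right (min_le_right _ _)).trans (by gcongr)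
      calc (#(F \ Z) : ℝ)
          ≤ (1 - ε) * #(F \ Z₀) + ε * (#(edgeBoundary T F) + #(edgeBoundary T⁻¹ Z₀)) :=
            card_sdiff_le_of_saturated hT hε₀ hZ₀Z hZF hsat
        _ ≤ (1 - ε) * (ρ * #F) + ε * (ρ / 4 * #F + ρ / 4 * #F) := by
            have := sub_pos.2 hε₁
            gcongr
            exact hFT
        _ = (1 - ε / 2) ^ (k + 1) * #F := by
            rw [pow_succ, ← hρ]
            ring

lemma exists_div_one_sub_le (a : ℝ) {η : ℝ} (hη : 0 < η) :
    ∃ ε, 0 < ε ∧ ε < 1 ∧ a / (1 - ε) ≤ a + η := by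
  have hlim : Tendsto (fun ε : ℝ ↦ a / (1 - ε)) (𝓝[>] 0) (𝓝 a) := by
    have : ContinuousAt (fun ε : ℝ ↦ a / (1 - ε)) 0 := by
      fun_prop (disch := norm_num)
    simpa using this.tendsto.mono_left nhdsWithin_le_nhds
  obtain ⟨ε, hε, hε₀, hε₁⟩ := ((hlim.eventually_le_const (lt_add_of_pos_right a hη)).and
    (Ioo_mem_nhdsGT one_pos)).exists
  exact ⟨ε, hε₀, hε₁, hε⟩

/-- The Ornstein–Weiss lemma. -/
theorem IsSubadditiveInvariant.eventually_le (hψ : IsSubadditiveInvariant ψ) (ha : 0 ≤ a)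
    (hsup : ∃ᶠ T in folner G, ψ T ≤ a * #T) {η : ℝ} (hη : 0 < η) :
    ∀ᶠ F in folner G, ψ F ≤ (a + η) * #F := by
  obtain ⟨ε, hε₀, hε₁, hεa⟩ := exists_div_one_sub_le a (half_pos hη)
  have hψ₁ : 0 ≤ ψ {1} := hψ.nonneg _
  obtain ⟨k, hk⟩ : ∃ k : ℕ, (1 - ε / 2) ^ k < η / 2 / (ψ {1} + 1) :=
    exists_pow_lt_of_lt_one (by positivity) (by linarith)
  filter_upwards [hψ.eventually_exists_quasiTiling hsup hε₀.le hε₁ k ∅ one_pos]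
    with F ⟨Z, hZF, hψZ, _, hrest⟩
  have hdiff : #(F \ Z) * ψ {1} ≤ η / 2 * #F :=
    calc #(F \ Z) * ψ {1} ≤ (η / 2 / (ψ {1} + 1) * #F) * (ψ {1} + 1) := by
          gcongr
          · exact hrest.trans (by gcongr)
          · linarith
      _ = η / 2 * #F := by field_simp
  calc ψ F = ψ (Z ∪ F \ Z) := by rw [Finset.union_sdiff_of_subset hZF]
    _ ≤ a / (1 - ε) * #Z + #(F \ Z) * ψ {1} :=
        (hψ.union_le _ _).trans (add_le_add hψZ (hψ.le_card_mul _))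
    _ ≤ (a + η / 2) * #F + η / 2 * #F := by gcongr
    _ = (a + η) * #F := by ring

end OrnsteinWeiss

section Words

/-- The factor of length `n` at position `i` of an infinite word. -/
def factor {α : Type*} (w : ℕ → α) (i n : ℕ) : List α := (List.range n).map fun j ↦ w (i + j)

variable {α : Type*} (w : ℕ → α)

@[simp] lemma length_factor (i n : ℕ) : (factor w i n).length = n := by simp [factor]

lemma factor_add (i m n : ℕ) : factor w i (m + n) = factor w i m ++ factor w (i + m) n := by
  simp [factor, List.range_add, Function.comp_def, add_assoc]

lemma factor_succ (i n : ℕ) : factor w i (n + 1) = factor w i n ++ [w (i + n)] := by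
  simp [factor, List.range_succ]

lemma factor_succ' (i n : ℕ) : factor w i (n + 1) = w i :: factor w (i + 1) n := by
  rw [add_comm n 1, factor_add]
  simp [factor]

lemma factor_zero_eq_ofFn (n : ℕ) : factor w 0 n = List.ofFn fun i : Fin n ↦ w i := by
  apply List.ext_getElem <;> simp [factor]

lemma factor_getD {v : List α} {n : ℕ} (hn : n ≤ v.length) (a : α) :
    factor (fun i ↦ v.getD i a) 0 n = v.take n := by
  apply List.ext_getElem
  · simp [hn]
  · intro i hi _
    rw [length_factor] at hi
    simp [factor, List.getElem?_eq_getElem (hi.trans_le hn)]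

lemma finite_range_factor [Finite α] (n : ℕ) : (Set.range fun i ↦ factor w i n).Finite :=
  (List.finite_length_eq α n).subset (by rintro _ ⟨i, rfl⟩; simp)

variable {w}

lemma factor_succ_eq_of_ncard_le [Finite α] {n : ℕ}
    (h : (Set.range fun i ↦ factor w i (n + 1)).ncard ≤ (Set.range fun i ↦ factor w i n).ncard)
    {i j : ℕ} (hij : factor w i n = factor w j n) : factor w i (n + 1) = factor w j (n + 1) := by
  have himage : List.take n '' (Set.range fun i ↦ factor w i (n + 1)) =
      Set.range fun i ↦ factor w i n := by
    rw [← Set.range_comp]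
    congr 1
    funext i
    simp [factor_succ]
  have hinj : Set.InjOn (List.take n) (Set.range fun i ↦ factor w i (n + 1)) := by
    refine Set.injOn_of_ncard_image_eq ?_ (finite_range_factor w _)
    exact le_antisymm (Set.ncard_image_le (finite_range_factor w _)) (himage ▸ h)
  exact hinj ⟨i, rfl⟩ ⟨j, rfl⟩ (by simpa [factor_succ] using hij)

/-- The Morse–Hedlund theorem. -/
lemma exists_period_of_ncard_le [Finite α] {n : ℕ}
    (h : (Set.range fun i ↦ factor w i (n + 1)).ncard ≤ (Set.range fun i ↦ factor w i n).ncard) :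
    ∃ i d, 0 < d ∧ ∀ k, w (i + d + k) = w (i + k) := by
  obtain ⟨i, -, j, -, hij, heq⟩ := Set.infinite_univ.exists_lt_map_eq_of_mapsTo
    (f := fun i ↦ factor w i n) (t := Set.range fun i ↦ factor w i n)
    (fun i _ ↦ ⟨i, rfl⟩) (finite_range_factor w n)
  have hcons (k : ℕ) (hk : factor w (i + k) n = factor w (j + k) n) :
      w (i + k) = w (j + k) ∧ factor w (i + k + 1) n = factor w (j + k + 1) n :=
    List.cons.inj (by simpa only [factor_succ'] using factor_succ_eq_of_ncard_le h hk)
  have hshift (k : ℕ) : factor w (i + k) n = factor w (j + k) n := by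
    induction k with
    | zero => exact heq
    | succ k ih => exact (hcons k ih).2
  refine ⟨i, j - i, by omega, fun k ↦ ?_⟩
  rw [show i + (j - i) = j by omega]
  exact (hcons k (hshift k)).1.symm

lemma succ_le_ncard_range_factor [Finite α]
    (h : ∀ n, (Set.range fun i ↦ factor w i n).ncard <
      (Set.range fun i ↦ factor w i (n + 1)).ncard) (n : ℕ) :
    n + 1 ≤ (Set.range fun i ↦ factor w i n).ncard := by
  induction n with
  | zero =>
    rw [Nat.succ_le_iff, Set.ncard_pos (finite_range_factor w 0)]
    exact Set.range_nonempty _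
  | succ n ih => exact ih.trans_lt (h n)

lemma factor_add_mul_of_periodic {i d : ℕ} (h : ∀ k, w (i + d + k) = w (i + k)) (k : ℕ) :
    factor w (i + k * d) d = factor w i d := by
  induction k with
  | zero => simp
  | succ k ih =>
    rw [← ih]
    refine List.map_congr_left fun j _ ↦ ?_
    have := h (k * d + j)
    rw [add_assoc i (k * d) j, ← this]
    ring_nf

end Words

section ReducedWords

variable {Γ : Type*} [Group Γ] {S : Finset Γ}

/-- The value in the group of a word in the elements of `S`. -/
def wordVal (w : List S) : Γ := (w.map Subtype.val).prod

/-- Words that are shortlex-minimal among the words with the same value: a set of normal forms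
closed under taking factors. -/
def IsReduced (w : List S) : Prop :=
  ∀ w', wordVal w' = wordVal w → ¬ List.Shortlex WellOrderingRel w' w

lemma wordVal_append (u v : List S) : wordVal (u ++ v) = wordVal u * wordVal v := by
  simp [wordVal]

lemma shortlex_append_right {α : Type*} {r : α → α → Prop} {s t : List α}
    (h : List.Shortlex r s t) (u : List α) : List.Shortlex r (s ++ u) (t ++ u) := by
  rcases List.shortlex_def.1 h with hlt | ⟨heq, hlex⟩
  · exact List.Shortlex.of_length_lt (by simpa using hlt)
  · refine List.Shortlex.of_lex (by simpa using heq) ?_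
    clear h
    induction hlex with
    | nil => simp at heq
    | cons _ ih => exact List.Lex.cons (ih (by simpa using heq))
    | rel h => exact List.Lex.rel h

namespace IsReduced

lemma of_append_left {u v : List S} (h : IsReduced (u ++ v)) : IsReduced u := fun w' hw' hlt ↦
  h (w' ++ v) (by simp [wordVal_append, hw']) (shortlex_append_right hlt _)

lemma of_append_right {u v : List S} (h : IsReduced (u ++ v)) : IsReduced v := fun w' hw' hlt ↦
  h (u ++ w') (by simp [wordVal_append, hw']) (hlt.append_left _)

lemma eq_of_wordVal_eq {u v : List S} (hu : IsReduced u) (hv : IsReduced v)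
    (h : wordVal u = wordVal v) : u = v :=
  Std.Trichotomous.trichotomous (r := List.Shortlex WellOrderingRel) u v (hv u h) (hu v h.symm)

end IsReduced

lemma exists_isReduced_wordVal_eq (u : List S) :
    ∃ v : List S, IsReduced v ∧ wordVal v = wordVal u := by
  have hwf : WellFounded (List.Shortlex (WellOrderingRel (α := S))) :=
    List.Shortlex.wf WellOrderingRel.isWellOrder.wf
  obtain ⟨v, hv, hmin⟩ := hwf.has_min {v : List S | wordVal v = wordVal u} ⟨u, rfl⟩
  exact ⟨v, fun w' hw' ↦ hmin w' (hw'.trans hv), hv⟩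

lemma wordVal_factor_mul {w : ℕ → S} {i d : ℕ} (h : ∀ k, w (i + d + k) = w (i + k)) (k : ℕ) :
    wordVal (factor w i (k * d)) = wordVal (factor w i d) ^ k := by
  induction k with
  | zero => simp [factor, wordVal]
  | succ k ih =>
    rw [add_mul, one_mul, factor_add, wordVal_append, ih, factor_add_mul_of_periodic h, pow_succ]

lemma not_isOfFinOrder_wordVal_of_periodic {w : ℕ → S} {i d : ℕ} (hd : 0 < d)
    (hw : ∀ n, IsReduced (factor w i n)) (h : ∀ k, w (i + d + k) = w (i + k)) :
    ¬ IsOfFinOrder (wordVal (factor w i d)) := fun hfin ↦ by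
  obtain ⟨k, hk, hpow⟩ := isOfFinOrder_iff_pow_eq_one.1 hfin
  rw [← wordVal_factor_mul h] at hpow
  refine hw (k * d) [] (by rw [hpow]; rfl) (List.Shortlex.of_length_lt ?_)
  simpa using ⟨hk, hd⟩

lemma isClosed_setOf_isReduced_factor [TopologicalSpace S] [DiscreteTopology S] (n : ℕ) :
    IsClosed {w : ℕ → S | IsReduced (factor w 0 n)} := by
  have hcont : Continuous fun (w : ℕ → S) (i : Fin n) ↦ w i :=
    continuous_pi fun i ↦ continuous_apply (i : ℕ)
  simp only [factor_zero_eq_ofFn]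
  exact (isClosed_discrete {f : Fin n → S | IsReduced (List.ofFn f)}).preimage hcont

variable [DecidableEq Γ]

lemma wordVal_mem_pow (w : List S) : wordVal w ∈ S ^ w.length := by
  induction w with
  | nil => simp [wordVal]
  | cons a w ih =>
    rw [List.length_cons, pow_succ']
    simp only [wordVal, List.map_cons, List.prod_cons]
    exact Finset.mul_mem_mul a.2 ih

lemma exists_wordVal_eq {n : ℕ} {g : Γ} (h : g ∈ S ^ n) : ∃ w : List S, wordVal w = g := by
  obtain ⟨f, rfl⟩ := Finset.mem_pow.1 h
  exact ⟨List.ofFn f, by rw [wordVal, List.map_ofFn]; rfl⟩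

lemma infinite_setOf_isReduced [Infinite Γ] (hgen : ∀ g : Γ, ∃ n, g ∈ S ^ n) :
    {v : List S | IsReduced v}.Infinite := fun hfin ↦ by
  refine Set.infinite_univ (α := Γ) ((hfin.image wordVal).subset fun g _ ↦ ?_)
  obtain ⟨u, rfl⟩ := exists_wordVal_eq (hgen g).choose_spec
  exact exists_isReduced_wordVal_eq u

lemma exists_isReduced_factor_zero [Infinite Γ] (hS : S.Nonempty)
    (hgen : ∀ g : Γ, ∃ n, g ∈ S ^ n) (n : ℕ) : ∃ w : ℕ → S, IsReduced (factor w 0 n) := by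
  obtain ⟨s, hs⟩ := hS
  obtain ⟨v, hv, hvn⟩ :=
    (infinite_setOf_isReduced hgen).exists_notMem_finite (List.finite_length_lt S n)
  refine ⟨fun i ↦ v.getD i ⟨s, hs⟩, ?_⟩
  rw [factor_getD (not_lt.1 hvn)]
  exact IsReduced.of_append_left (v := v.drop n) (by rwa [List.take_append_drop])

lemma exists_forall_isReduced_factor [Infinite Γ] (hS : S.Nonempty)
    (hgen : ∀ g : Γ, ∃ n, g ∈ S ^ n) : ∃ w : ℕ → S, ∀ i n, IsReduced (factor w i n) := by
  let _ : TopologicalSpace S := ⊥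
  have : DiscreteTopology S := ⟨rfl⟩
  obtain ⟨w, hw⟩ := IsCompact.nonempty_iInter_of_sequence_nonempty_isCompact_isClosed
    (fun n ↦ {w : ℕ → S | IsReduced (factor w 0 n)})
    (fun n w hw ↦ by
      rw [Set.mem_ofPred_eq, factor_succ] at hw
      exact hw.of_append_left)
    (exists_isReduced_factor_zero hS hgen) (isClosed_setOf_isReduced_factor 0).isCompact
    isClosed_setOf_isReduced_factor
  refine ⟨w, fun i n ↦ ?_⟩
  have hin : IsReduced (factor w 0 (i + n)) := Set.mem_iInter.1 hw (i + n)
  rw [factor_add, zero_add] at hin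
  exact hin.of_append_right

lemma sum_ncard_range_factor_le_card_pow (hS : (1 : Γ) ∈ S) {w : ℕ → S}
    (hw : ∀ i n, IsReduced (factor w i n)) (R : ℕ) :
    ∑ n ∈ Finset.range (R + 1), (Set.range fun i ↦ factor w i n).ncard ≤ #(S ^ R) := by
  classical
  let P (n : ℕ) : Finset (List S) := (finite_range_factor w n).toFinset
  have hmem {n : ℕ} {u : List S} : u ∈ P n ↔ ∃ i, factor w i n = u := by simp [P]
  calc ∑ n ∈ Finset.range (R + 1), (Set.range fun i ↦ factor w i n).ncard
      = ∑ n ∈ Finset.range (R + 1), #(P n) :=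
        Finset.sum_congr rfl fun n _ ↦ Set.ncard_eq_toFinset_card _ _
    _ = #((Finset.range (R + 1)).biUnion P) := by
        refine (Finset.card_biUnion fun m _ n _ hmn ↦ Finset.disjoint_left.2 fun u hu hv ↦ ?_).symm
        obtain ⟨i, rfl⟩ := hmem.1 hu
        obtain ⟨j, hj⟩ := hmem.1 hv
        exact hmn (by simpa using (congrArg List.length hj).symm)
    _ ≤ #(S ^ R) := by
        refine Finset.card_le_card_of_injOn wordVal (fun u hu ↦ ?_) (fun u hu v hv huv ↦ ?_)
        · obtain ⟨n, hn, hun⟩ := Finset.mem_biUnion.1 hu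
          obtain ⟨i, rfl⟩ := hmem.1 hun
          have hval := wordVal_mem_pow (factor w i n)
          rw [length_factor] at hval
          exact Finset.pow_subset_pow_right hS (Nat.lt_succ_iff.1 (Finset.mem_range.1 hn)) hval
        · obtain ⟨n, -, hun⟩ := Finset.mem_biUnion.1 hu
          obtain ⟨m, -, hvm⟩ := Finset.mem_biUnion.1 hv
          obtain ⟨i, rfl⟩ := hmem.1 hun
          obtain ⟨j, rfl⟩ := hmem.1 hvm
          exact (hw i n).eq_of_wordVal_eq (hw j m) huv

end ReducedWords

section Growth

variable {Γ : Type*} [Group Γ] [DecidableEq Γ] {S : Finset Γ} {M : ℕ}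

/-- A reduced infinite word is either eventually periodic, and the value of its period has infinite
order, or it has at least `n + 1` factors of each length `n`, and the growth is quadratic. -/
lemma exists_not_isOfFinOrder_of_linear_growth [Infinite Γ] (hS : (1 : Γ) ∈ S)
    (hgen : ∀ g : Γ, ∃ n, g ∈ S ^ n) (hM : ∀ r, 1 ≤ r → #(S ^ r) < M * r) :
    ∃ g : Γ, ¬ IsOfFinOrder g := by
  obtain ⟨w, hw⟩ := exists_forall_isReduced_factor ⟨1, hS⟩ hgen
  by_cases hper : ∃ n, (Set.range fun i ↦ factor w i (n + 1)).ncard ≤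
      (Set.range fun i ↦ factor w i n).ncard
  · obtain ⟨n, hn⟩ := hper
    obtain ⟨i, d, hd, hid⟩ := exists_period_of_ncard_le hn
    exact ⟨_, not_isOfFinOrder_wordVal_of_periodic hd (hw i) hid⟩
  · exfalso
    push Not at hper
    have hsum (R : ℕ) : (R + 2) * (R + 1) ≤ #(S ^ R) * 2 :=
      calc (R + 2) * (R + 1) = (∑ n ∈ Finset.range (R + 1), (n + 1)) * 2 := by
            have hgauss := Finset.sum_range_id_mul_two (R + 2)
            rw [Finset.sum_range_succ' _ (R + 1)] at hgauss
            exact hgauss.symm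
        _ ≤ #(S ^ R) * 2 := by
            gcongr
            exact (Finset.sum_le_sum fun n _ ↦ succ_le_ncard_range_factor hper n).trans
              (sum_ncard_range_factor_le_card_pow hS hw R)
    nlinarith [hsum (2 * M + 1), hM (2 * M + 1) (by omega)]

lemma succ_le_card_pow_smul_singleton {α : Type*} [DecidableEq α] [MulAction Γ α]
    [MulAction.IsPretransitive Γ α] [Infinite α] (hS : (1 : Γ) ∈ S)
    (hgen : ∀ g : Γ, ∃ n, g ∈ S ^ n) (x : α) (r : ℕ) : r + 1 ≤ #(S ^ r • ({x} : Finset α)) := by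
  induction r with
  | zero => simp
  | succ r ih =>
    have hsub : S ^ r • ({x} : Finset α) ⊆ S ^ (r + 1) • {x} :=
      Finset.smul_subset_smul_right (Finset.pow_subset_pow_right hS r.le_succ)
    refine ih.trans_lt (Finset.card_lt_card (hsub.ssubset_of_ne fun heq ↦ ?_))
    have hstable (n : ℕ) : S ^ n • S ^ r • ({x} : Finset α) = S ^ r • {x} := by
      induction n with
      | zero => simp
      | succ n ihn => rw [pow_succ, ← smul_smul, smul_smul S, ← pow_succ', ← heq, ihn]
    refine Set.infinite_univ (α := α) ((S ^ r • ({x} : Finset α)).finite_toSet.subset fun y _ ↦ ?_)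
    obtain ⟨g, rfl⟩ := MulAction.exists_smul_eq Γ x y
    obtain ⟨n, hn⟩ := hgen g
    have hx : x ∈ S ^ r • ({x} : Finset α) :=
      Finset.mem_smul.2 ⟨1, Finset.one_mem_pow hS, x, Finset.mem_singleton_self x, one_smul Γ x⟩
    rw [Finset.mem_coe, ← hstable n]
    exact Finset.smul_mem_smul hn hx

lemma card_smul_singleton_mul_card_le {α : Type*} [DecidableEq α] [MulAction Γ α] {x : α}
    {A B : Finset Γ} (hB : ∀ b ∈ B, b • x = x) :
    #(A • ({x} : Finset α)) * #B ≤ #(A * B) := by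
  obtain ⟨A', hA', hinj, himage⟩ := Finset.exists_subset_injOn_image_eq_of_surjOn (A : Set Γ)
    (A • {x}) (f := (· • x)) fun y hy ↦ by simpa [Finset.mem_smul] using hy
  rw [← himage, Finset.card_image_of_injOn hinj]
  refine (Finset.card_mul_iff.2 ?_).ge.trans
    (Finset.card_le_card (Finset.mul_subset_mul_right (Finset.coe_subset.1 hA')))
  rintro ⟨a, b⟩ ⟨ha, hb⟩ ⟨a', b'⟩ ⟨ha', hb'⟩ heq
  have hax : a • x = a' • x := by
    simpa [mul_smul, hB b hb, hB b' hb'] using congrArg (· • x) heq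
  obtain rfl : a = a' := hinj ha ha' hax
  exact Prod.ext rfl (mul_left_cancel heq)

lemma finiteIndex_zpowers_of_linear_growth (hS : (1 : Γ) ∈ S)
    (hgen : ∀ g : Γ, ∃ n, g ∈ S ^ n) (hM : ∀ r, 1 ≤ r → #(S ^ r) < M * r)
    {g : Γ} (hg : ¬ IsOfFinOrder g) : (Subgroup.zpowers g).FiniteIndex := by
  classical
  by_contra hindex
  have hinf : Infinite (Γ ⧸ Subgroup.zpowers g) := by
    rw [← not_finite_iff_infinite]
    exact fun _ ↦ hindex Subgroup.finiteIndex_of_finite_quotient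
  obtain ⟨k, hk⟩ := hgen g
  have hquadratic (r : ℕ) : (r + 1) * (r + 1) ≤ #(S ^ (r + k * r)) := by
    let x : Γ ⧸ Subgroup.zpowers g := ((1 : Γ) : Γ ⧸ Subgroup.zpowers g)
    let B := (Finset.range (r + 1)).image (g ^ ·)
    have hfix : ∀ b ∈ B, b • x = x := by
      refine Finset.forall_mem_image.2 fun i _ ↦ ?_
      rw [← MulAction.mem_stabilizer_iff, MulAction.stabilizer_quotient]
      exact Subgroup.pow_mem _ (Subgroup.mem_zpowers g) i
    have hB : B ⊆ S ^ (k * r) := by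
      refine Finset.image_subset_iff.2 fun i hi ↦ ?_
      have hgi : g ^ i ∈ S ^ (k * i) := pow_mul S k i ▸ Finset.pow_mem_pow hk
      exact Finset.pow_subset_pow_right hS
        (Nat.mul_le_mul_left _ (Nat.lt_succ_iff.1 (Finset.mem_range.1 hi))) hgi
    calc (r + 1) * (r + 1) ≤ #(S ^ r • ({x} : Finset (Γ ⧸ Subgroup.zpowers g))) * #B := by
          rw [Finset.card_image_of_injective _ (injective_pow_iff_not_isOfFinOrder.2 hg),
            Finset.card_range]
          gcongr
          exact succ_le_card_pow_smul_singleton hS hgen x r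
      _ ≤ #(S ^ r * B) := card_smul_singleton_mul_card_le hfix
      _ ≤ #(S ^ (r + k * r)) := by
          rw [pow_add]
          gcongr
  have hlower := hquadratic (M * (k + 1) + 1)
  have hupper := hM (M * (k + 1) + 1 + k * (M * (k + 1) + 1)) (by omega)
  nlinarith

lemma isVirtuallyCyclic_of_linear_growth (hS : (1 : Γ) ∈ S)
    (hgen : ∀ g : Γ, ∃ n, g ∈ S ^ n) (hM : ∀ r, 1 ≤ r → #(S ^ r) < M * r) :
    IsVirtuallyCyclic Γ := by
  rcases finite_or_infinite Γ with hfin | hinf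
  · exact ⟨⊥, inferInstance, inferInstance⟩
  · obtain ⟨g, hg⟩ := exists_not_isOfFinOrder_of_linear_growth hS hgen hM
    exact ⟨Subgroup.zpowers g, inferInstance, finiteIndex_zpowers_of_linear_growth hS hgen hM hg⟩

lemma exists_mem_pow_of_closure_eq_top (hinv : S⁻¹ = S)
    (h : Subgroup.closure (S : Set Γ) = ⊤) (g : Γ) : ∃ n, g ∈ S ^ n := by
  have hg : g ∈ Subgroup.closure (S : Set Γ) := h ▸ Subgroup.mem_top g
  induction hg using Subgroup.closure_induction with
  | mem x hx => exact ⟨1, by simpa using hx⟩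
  | one => exact ⟨0, by simp⟩
  | mul x y _ _ hx hy =>
    obtain ⟨m, hm⟩ := hx
    obtain ⟨n, hn⟩ := hy
    exact ⟨m + n, by rw [pow_add]; exact Finset.mul_mem_mul hm hn⟩
  | inv x _ hx =>
    obtain ⟨m, hm⟩ := hx
    exact ⟨m, by rw [← hinv, inv_pow]; exact Finset.inv_mem_inv hm⟩

lemma exists_symm_closure_eq_top [Group.FG Γ] :
    ∃ B : Finset Γ, 1 ∈ B ∧ B⁻¹ = B ∧ Subgroup.closure (B : Set Γ) = ⊤ := by
  obtain ⟨A, hA⟩ := (inferInstance : Group.FG Γ).out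
  refine ⟨insert 1 (A ∪ A⁻¹), Finset.mem_insert_self _ _, ?_, ?_⟩
  · ext x
    simp only [Finset.mem_inv', Finset.mem_insert, Finset.mem_union, inv_eq_one, inv_inv]
    tauto
  · refine top_le_iff.1 (hA.ge.trans (Subgroup.closure_mono ?_))
    exact_mod_cast Finset.subset_union_left.trans (Finset.subset_insert _ _)

theorem exists_superlinear_growth (h : ¬ IsLocallyVirtuallyCyclic Γ) :
    ∃ S : Finset Γ, 1 ∈ S ∧ S⁻¹ = S ∧ ∀ M : ℕ, ∃ r, 1 ≤ r ∧ M * r ≤ #(S ^ r) := by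
  unfold IsLocallyVirtuallyCyclic at h
  push Not at h
  obtain ⟨K, hK, hKc⟩ := h
  have : Group.FG K := (Group.fg_iff_subgroup_fg K).2 hK
  obtain ⟨B, hB, hBinv, hBgen⟩ := exists_symm_closure_eq_top (Γ := K)
  refine ⟨B.image K.subtype, Finset.mem_image.2 ⟨1, hB, rfl⟩, ?_, fun M ↦ ?_⟩
  · rw [← Finset.image_inv, hBinv]
  · by_contra! hlinear
    refine hKc (isVirtuallyCyclic_of_linear_growth hB
      (exists_mem_pow_of_closure_eq_top hBinv hBgen) (M := M) fun r hr ↦ ?_)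
    have hcard := hlinear r hr
    rwa [← Finset.image_pow, Finset.card_image_of_injective _ K.subtype_injective] at hcard

end Growth

section Covers

variable {X : Type*} {𝒰 : Set (Set X)}

lemma minSubcover_le_of_refine {ι : Type*} [Finite ι] (f : ι → Set X)
    (hcov : ∀ x, ∃ i, x ∈ f i) (href : ∀ i, ∀ x ∈ f i, ∃ W ∈ 𝒰, f i ⊆ W) :
    minSubcover 𝒰 ≤ Nat.card ι := by
  choose! W hW hfW using fun i (h : (f i).Nonempty) ↦ h.elim (href i)
  have hfin : {i | (f i).Nonempty}.Finite := Set.toFinite _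
  have hcard : (W '' {i | (f i).Nonempty}).ncard ≤ Nat.card ι :=
    (Set.ncard_image_le hfin).trans (Set.ncard_le_card _)
  have hunion : ⋃₀ (W '' {i | (f i).Nonempty}) = Set.univ := Set.eq_univ_of_forall fun x ↦ by
    obtain ⟨i, hi⟩ := hcov x
    exact ⟨W i, ⟨i, ⟨x, hi⟩, rfl⟩, hfW i ⟨x, hi⟩ hi⟩
  have hle : minSubcover 𝒰 ≤ (W '' {i | (f i).Nonempty}).ncard :=
    Nat.sInf_le ⟨_, Set.image_subset_iff.2 hW, hfin.image W, hunion, rfl⟩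
  exact hle.trans hcard

lemma exists_minSubcover (hfin : 𝒰.Finite) (hcov : ⋃₀ 𝒰 = Set.univ) :
    ∃ f : Fin (minSubcover 𝒰) → Set X, (∀ i, f i ∈ 𝒰) ∧ ∀ x, ∃ i, x ∈ f i := by
  obtain ⟨𝒱, hsub, hfin𝒱, hcov𝒱, hcard⟩ : minSubcover 𝒰 ∈
      {n | ∃ 𝒱 ⊆ 𝒰, 𝒱.Finite ∧ ⋃₀ 𝒱 = Set.univ ∧ 𝒱.ncard = n} :=
    Nat.sInf_mem ⟨_, 𝒰, subset_rfl, hfin, hcov, rfl⟩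
  have := hfin𝒱.to_subtype
  let e : 𝒱 ≃ Fin (minSubcover 𝒰) := Finite.equivFinOfCardEq hcard
  refine ⟨fun i ↦ e.symm i, fun i ↦ hsub (e.symm i).2, fun x ↦ ?_⟩
  obtain ⟨V, hV, hxV⟩ : x ∈ ⋃₀ 𝒱 := hcov𝒱 ▸ Set.mem_univ x
  exact ⟨e ⟨V, hV⟩, by simpa using hxV⟩

lemma log_natCast_le_of_le_mul {k m n : ℕ} (h : k ≤ m * n) :
    Real.log k ≤ Real.log m + Real.log n := by
  rcases k.eq_zero_or_pos with rfl | hk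
  · simpa using add_nonneg (Real.log_natCast_nonneg m) (Real.log_natCast_nonneg n)
  · have hmn : m * n ≠ 0 := (hk.trans_le h).ne'
    rw [← Real.log_mul (mod_cast left_ne_zero_of_mul hmn) (mod_cast right_ne_zero_of_mul hmn)]
    exact Real.log_le_log (mod_cast hk) (mod_cast h)

variable {G : Type*} [Group G] [MulAction G X]

lemma mem_iInter_inv_smul {F : Finset G} {U : G → Set X} {x : X} :
    x ∈ ⋂ s ∈ F, s⁻¹ • U s ↔ ∀ s ∈ F, s • x ∈ U s := by
  simp [Set.mem_inv_smul_set_iff]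

lemma finite_coverJoin (h : 𝒰.Finite) (F : Finset G) : (coverJoin 𝒰 F).Finite := by
  have := h.to_subtype
  refine (Set.finite_range fun u : F → 𝒰 ↦ ⋂ s : F, (s : G)⁻¹ • (u s : Set X)).subset ?_
  rintro W ⟨U, hU, rfl⟩
  refine ⟨fun s ↦ ⟨U s, hU s s.2⟩, ?_⟩
  ext x
  simp

lemma sUnion_coverJoin (h : ⋃₀ 𝒰 = Set.univ) (F : Finset G) : ⋃₀ coverJoin 𝒰 F = Set.univ := by
  have hmem (x : X) : ∃ U ∈ 𝒰, x ∈ U := Set.mem_sUnion.1 (h ▸ Set.mem_univ x)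
  refine Set.eq_univ_of_forall fun x ↦ ?_
  choose U hU hxU using fun s : G ↦ hmem (s • x)
  exact ⟨_, ⟨U, fun s _ ↦ hU s, rfl⟩, mem_iInter_inv_smul.2 fun s _ ↦ hxU s⟩

lemma minSubcover_coverJoin_empty_le (𝒰 : Set (Set X)) :
    minSubcover (coverJoin 𝒰 (∅ : Finset G)) ≤ 1 := by
  have hle := minSubcover_le_of_refine (𝒰 := coverJoin 𝒰 (∅ : Finset G))
    (fun _ : Unit ↦ Set.univ) (fun x ↦ ⟨(), Set.mem_univ x⟩)
    fun _ _ _ ↦ ⟨_, ⟨fun _ ↦ ∅, by simp, rfl⟩, by simp⟩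
  simpa using hle

variable [TopologicalSpace X]

lemma IsFiniteOpenCover.exists_subcover_coverJoin (h : IsFiniteOpenCover 𝒰) (A : Finset G) :
    ∃ U : Fin (minSubcover (coverJoin 𝒰 A)) → G → Set X,
      (∀ i, ∀ s ∈ A, U i s ∈ 𝒰) ∧ ∀ x, ∃ i, ∀ s ∈ A, s • x ∈ U i s := by
  obtain ⟨f, hf, hcov⟩ := exists_minSubcover (finite_coverJoin h.finite A)
    (sUnion_coverJoin h.cover A)
  choose U hU hfU using hf
  simp only [hfU, mem_iInter_inv_smul] at hcov
  exact ⟨U, hU, hcov⟩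

variable [DecidableEq G]

lemma minSubcover_coverJoin_union_le (h : IsFiniteOpenCover 𝒰) (A B : Finset G) :
    minSubcover (coverJoin 𝒰 (A ∪ B)) ≤
      minSubcover (coverJoin 𝒰 A) * minSubcover (coverJoin 𝒰 B) := by
  obtain ⟨U, hU, hUcov⟩ := h.exists_subcover_coverJoin A
  obtain ⟨V, hV, hVcov⟩ := h.exists_subcover_coverJoin B
  refine (minSubcover_le_of_refine (𝒰 := coverJoin 𝒰 (A ∪ B))
    (fun p : Fin (minSubcover (coverJoin 𝒰 A)) × Fin (minSubcover (coverJoin 𝒰 B)) ↦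
      (⋂ s ∈ A, s⁻¹ • U p.1 s) ∩ ⋂ s ∈ B, s⁻¹ • V p.2 s) (fun x ↦ ?_) fun p _ _ ↦ ?_).trans
    (by simp)
  · obtain ⟨i, hi⟩ := hUcov x
    obtain ⟨j, hj⟩ := hVcov x
    exact ⟨(i, j), mem_iInter_inv_smul.2 hi, mem_iInter_inv_smul.2 hj⟩
  · refine ⟨_, ⟨fun s ↦ if s ∈ A then U p.1 s else V p.2 s, fun s hs ↦ ?_, rfl⟩,
      fun x ⟨hxA, hxB⟩ ↦ mem_iInter_inv_smul.2 fun s hs ↦ ?_⟩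
    · beta_reduce
      split_ifs with hsA
      · exact hU _ s hsA
      · exact hV _ s ((Finset.mem_union.1 hs).resolve_left hsA)
    · split_ifs with hsA
      · exact mem_iInter_inv_smul.1 hxA s hsA
      · exact mem_iInter_inv_smul.1 hxB s ((Finset.mem_union.1 hs).resolve_left hsA)

lemma minSubcover_coverJoin_op_smul_le (h : IsFiniteOpenCover 𝒰) (A : Finset G) (c : G) :
    minSubcover (coverJoin 𝒰 (A <• c)) ≤ minSubcover (coverJoin 𝒰 A) := by
  obtain ⟨U, hU, hcov⟩ := h.exists_subcover_coverJoin A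
  refine (minSubcover_le_of_refine (𝒰 := coverJoin 𝒰 (A <• c))
    (fun i ↦ {x | ∀ s ∈ A, s • c • x ∈ U i s}) (fun x ↦ hcov (c • x))
    fun i _ _ ↦ ?_).trans (by simp)
  refine ⟨_, ⟨fun s ↦ U i (s * c⁻¹), fun s hs ↦ hU i _ (mem_op_smul_finset.1 hs), rfl⟩,
    fun x hx ↦ mem_iInter_inv_smul.2 fun s hs ↦ ?_⟩
  simpa [smul_smul] using hx _ (mem_op_smul_finset.1 hs)

lemma isSubadditiveInvariant_log_minSubcover (h : IsFiniteOpenCover 𝒰) :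
    IsSubadditiveInvariant fun A : Finset G ↦ Real.log (minSubcover (coverJoin 𝒰 A)) where
  nonneg _ := Real.log_natCast_nonneg _
  empty := le_antisymm
    (Real.log_nonpos (Nat.cast_nonneg _) (mod_cast minSubcover_coverJoin_empty_le 𝒰))
    (Real.log_natCast_nonneg _)
  union_le A B := log_natCast_le_of_le_mul (minSubcover_coverJoin_union_le h A B)
  op_smul_le A c := by
    simpa using log_natCast_le_of_le_mul (n := 1)
      (by simpa using minSubcover_coverJoin_op_smul_le h A c)

end Covers

section Entropy

variable {G X : Type*} [Group G] [DecidableEq G] [TopologicalSpace X] [MulAction G X]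
  {𝒰 : Set (Set X)} {F : ℕ → Finset G} {a η : ℝ}

omit [DecidableEq G] in
lemma topEntropy_nonneg (F : ℕ → Finset G) : 0 ≤ topEntropy X F := by
  have huniv : IsFiniteOpenCover ({Set.univ} : Set (Set X)) :=
    ⟨Set.finite_singleton _, by simp, by simp⟩
  refine le_iSup_of_le ⟨{Set.univ}, huniv⟩
    (le_limsup_of_frequently_le (Frequently.of_forall fun n ↦ ?_) (by isBoundedDefault))
  exact EReal.coe_nonneg.2 (div_nonneg (Real.log_natCast_nonneg _) (Nat.cast_nonneg _))

lemma eventually_log_minSubcover_le_of_topEntropy_lt (hF : IsFolnerSeq F) (ha : 0 ≤ a)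
    (haF : topEntropy X F < a) (h : IsFiniteOpenCover 𝒰) (hη : 0 < η) :
    ∀ᶠ A in folner G, Real.log (minSubcover (coverJoin 𝒰 A)) ≤ (a + η) * #A := by
  refine (isSubadditiveInvariant_log_minSubcover h).eventually_le ha
    (hF.tendsto_folner.frequently (Eventually.frequently ?_)) hη
  have hlim : limsup (fun n ↦ ((Real.log (minSubcover (coverJoin 𝒰 (F n))) / #(F n) : ℝ) : EReal))
      atTop < a := (le_iSup _ (⟨𝒰, h⟩ : {𝒰 : Set (Set X) // IsFiniteOpenCover 𝒰})).trans_lt haF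
  filter_upwards [eventually_lt_of_limsup_lt hlim, hF.eventually_nonempty] with n hn hne
  exact (div_le_iff₀ (mod_cast hne.card_pos)).1 (EReal.coe_lt_coe_iff.1 hn).le

lemma topEntropy_le_of_frequently (hF : IsFolnerSeq F) (ha : 0 ≤ a)
    (h : ∀ 𝒰 : Set (Set X), IsFiniteOpenCover 𝒰 → ∀ η > 0,
      ∃ᶠ T in folner G, Real.log (minSubcover (coverJoin 𝒰 T)) ≤ (a + η) * #T) :
    topEntropy X F ≤ a := by
  refine iSup_le fun 𝒰 ↦ EReal.le_of_forall_lt_iff_le.1 fun b hb ↦ ?_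
  have hη : 0 < (b - a) / 2 := half_pos (sub_pos.2 (EReal.coe_lt_coe_iff.1 hb))
  have hupper := hF.tendsto_folner.eventually
    ((isSubadditiveInvariant_log_minSubcover 𝒰.2).eventually_le (by positivity)
      (h 𝒰.1 𝒰.2 _ hη) hη)
  refine limsup_le_of_le (by isBoundedDefault) ?_
  filter_upwards [hupper, hF.eventually_nonempty] with n hn hne
  rw [EReal.coe_le_coe_iff, div_le_iff₀ (mod_cast hne.card_pos)]
  exact hn.trans_eq (by ring)

end Entropy

section OrbitEquivalence

variable {G H X Y : Type*} [Group G] [TopologicalSpace G] [TopologicalSpace X] [MulAction G X]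
  [Group H] [TopologicalSpace H] [TopologicalSpace Y] [MulAction H Y]

lemma ContinuouslyOrbitEquivalent.symm (h : ContinuouslyOrbitEquivalent G X H Y) :
    ContinuouslyOrbitEquivalent H Y G X := by
  obtain ⟨Φ, κ, l, hκ, hl, hΦκ, hΦl⟩ := h
  exact ⟨Φ.symm, l, κ, hl, hκ, hΦl, hΦκ⟩

omit [TopologicalSpace G] [TopologicalSpace X] in
lemma eq_of_smul_eq_of_stabilizer_eq_bot {x : X} (hx : MulAction.stabilizer G x = ⊥) {g g' : G}
    (h : g • x = g' • x) : g = g' := by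
  have hmem : g'⁻¹ * g ∈ MulAction.stabilizer G x := by
    rw [MulAction.mem_stabilizer_iff, mul_smul, h, inv_smul_smul]
  rw [hx, Subgroup.mem_bot] at hmem
  exact (inv_mul_eq_one.1 hmem).symm

omit [TopologicalSpace H] in
lemma IsTopologicallyFree.cocycle_mul [T2Space G] [ContinuousMul G] [ContinuousConstSMul H Y]
    (hX : IsTopologicallyFree G X) (ψ : Y ≃ₜ X) {l : H → Y → G} (hl : ∀ t, Continuous (l t))
    (hψ : ∀ t y, ψ (t • y) = l t y • ψ y) (s t : H) (y : Y) :
    l (s * t) y = l s (t • y) * l t y := by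
  refine congrFun (Continuous.ext_on (hX.preimage ψ.isOpenMap) (hl (s * t))
    (((hl s).comp (continuous_const_smul t)).mul (hl t)) fun y hy ↦ ?_) y
  refine eq_of_smul_eq_of_stabilizer_eq_bot hy ?_
  rw [← hψ, mul_smul, hψ, hψ, smul_smul]
  rfl

lemma IsTopologicallyFree.cocycle_comp [T2Space G] (hX : IsTopologicallyFree G X) (Φ : X ≃ₜ Y)
    {κ : G × X → H} {l : H × Y → G} (hκ : Continuous κ) (hl : Continuous l)
    (hΦκ : ∀ s x, Φ (s • x) = κ (s, x) • Φ x)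
    (hΦl : ∀ t y, Φ.symm (t • y) = l (t, y) • Φ.symm y) (g : G) (x : X) :
    l (κ (g, x), Φ x) = g := by
  refine congrFun (Continuous.ext_on hX (f := fun x ↦ l (κ (g, x), Φ x)) (by fun_prop)
    continuous_const fun x hx ↦ eq_of_smul_eq_of_stabilizer_eq_bot hx ?_) x
  simpa [← hΦκ] using (hΦl (κ (g, x)) (Φ x)).symm

end OrbitEquivalence

/-- A continuous orbit equivalence `Φ` of actions of discrete groups on compact spaces together
with its pair of mutually inverse cocycles. The cocycle `l` with values in `G` is read on `X`, so
that `l t x` is the element of `G` that moves `x` as `t` moves `Φ x`. -/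
structure OrbitCocycle (G H X Y : Type*) [Group G] [TopologicalSpace X] [MulAction G X]
    [Group H] [TopologicalSpace Y] [MulAction H Y] where
  Φ : X ≃ₜ Y
  k : G → X → H
  l : H → X → G
  l_mul : ∀ s t x, l (s * t) x = l s (l t x • x) * l t x
  k_l : ∀ t x, k (l t x) x = t
  l_k : ∀ g x, l (k g x) x = g
  Φ_l : ∀ t x, Φ (l t x • x) = t • Φ x
  isOpen_l : ∀ t g, IsOpen {x | l t x = g}
  finite_k : ∀ g, (Set.range (k g)).Finite
  finite_l : ∀ t, (Set.range (l t)).Finite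

lemma ContinuouslyOrbitEquivalent.nonempty_orbitCocycle {G H X Y : Type*}
    [Group G] [TopologicalSpace G] [DiscreteTopology G]
    [Group H] [TopologicalSpace H] [DiscreteTopology H]
    [TopologicalSpace X] [CompactSpace X] [TopologicalSpace Y]
    [MulAction G X] [MulAction H Y] [ContinuousConstSMul H Y]
    (hX : IsTopologicallyFree G X) (hY : IsTopologicallyFree H Y)
    (h : ContinuouslyOrbitEquivalent G X H Y) : Nonempty (OrbitCocycle G H X Y) := by
  obtain ⟨Φ, κ, l, hκ, hl, hΦκ, hΦl⟩ := h
  have hΦ (t : H) (x : X) : Φ (l (t, Φ x) • x) = t • Φ x := by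
    simpa using (congrArg Φ (hΦl t (Φ x))).symm
  have hκg (g : G) : Continuous fun x ↦ κ (g, x) := by fun_prop
  have hlt (t : H) : Continuous fun x ↦ l (t, Φ x) := by fun_prop
  refine ⟨⟨Φ, fun g x ↦ κ (g, x), fun t x ↦ l (t, Φ x), fun s t x ↦ ?_, fun t x ↦ ?_,
    hX.cocycle_comp Φ hκ hl hΦκ hΦl, hΦ, fun t g ↦ (isOpen_discrete {g}).preimage (hlt t),
    fun g ↦ (isCompact_range (hκg g)).finite_of_discrete,
    fun t ↦ (isCompact_range (hlt t)).finite_of_discrete⟩⟩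
  · rw [hΦ]
    exact hX.cocycle_mul Φ.symm (l := fun t y ↦ l (t, y)) (fun t ↦ by fun_prop) hΦl s t (Φ x)
  · simpa using hY.cocycle_comp Φ.symm hl hκ hΦl hΦκ t (Φ x)

namespace OrbitCocycle

variable {G H X Y : Type*} [Group G] [TopologicalSpace X] [MulAction G X]
  [Group H] [TopologicalSpace Y] [MulAction H Y] {c : OrbitCocycle G H X Y}

lemma l_injective (c : OrbitCocycle G H X Y) (x : X) : Function.Injective fun t ↦ c.l t x :=
  Function.LeftInverse.injective (g := fun g ↦ c.k g x) fun t ↦ c.k_l t x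

lemma l_one (c : OrbitCocycle G H X Y) (x : X) : c.l 1 x = 1 := by
  have hfix : c.l 1 x • x = x := c.Φ.injective (by rw [c.Φ_l, one_smul])
  simpa [hfix] using c.l_mul 1 1 x

/-- The finite set of values of the cocycle `k` on `A`. -/
noncomputable def kVals [DecidableEq H] (c : OrbitCocycle G H X Y) (A : Finset G) : Finset H :=
  A.biUnion fun g ↦ (c.finite_k g).toFinset

lemma k_mem_kVals [DecidableEq H] {A : Finset G} {g : G} (hg : g ∈ A) (x : X) :
    c.k g x ∈ c.kVals A :=
  Finset.mem_biUnion.2 ⟨g, hg, by simp⟩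

variable [DecidableEq G]

/-- The finite set of values of the cocycle `l` on `A`. -/
noncomputable def lVals (c : OrbitCocycle G H X Y) (A : Finset H) : Finset G :=
  A.biUnion fun t ↦ (c.finite_l t).toFinset

lemma mem_lVals {A : Finset H} {g : G} : g ∈ c.lVals A ↔ ∃ t ∈ A, ∃ x, c.l t x = g := by
  simp [lVals]

lemma l_mem_lVals {A : Finset H} {t : H} (ht : t ∈ A) (x : X) : c.l t x ∈ c.lVals A :=
  mem_lVals.2 ⟨t, ht, x, rfl⟩

lemma lVals_nonempty [Nonempty X] {A : Finset H} (hA : A.Nonempty) : (c.lVals A).Nonempty :=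
  hA.elim fun _ ht ↦ ⟨_, l_mem_lVals ht (Classical.arbitrary X)⟩

/-- The subset of `G` corresponding to `T` along the orbit of `x`. -/
def shape (c : OrbitCocycle G H X Y) (T : Finset H) (x : X) : Finset G := T.image fun t ↦ c.l t x

lemma card_shape (T : Finset H) (x : X) : #(c.shape T x) = #T :=
  Finset.card_image_of_injective _ (c.l_injective x)

lemma l_mem_shape {T : Finset H} {t : H} {x : X} : c.l t x ∈ c.shape T x ↔ t ∈ T :=
  (c.l_injective x).mem_finset_image

variable [DecidableEq H]

lemma card_lVals_mul_le (A B : Finset H) : #(c.lVals (A * B)) ≤ #(c.lVals A) * #(c.lVals B) := by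
  refine (Finset.card_le_card fun g hg ↦ ?_).trans Finset.card_mul_le
  obtain ⟨t, ht, x, rfl⟩ := mem_lVals.1 hg
  obtain ⟨a, ha, b, hb, rfl⟩ := Finset.mem_mul.1 ht
  rw [c.l_mul]
  exact Finset.mul_mem_mul (l_mem_lVals ha _) (l_mem_lVals hb _)

lemma card_lVals_pow_le (A : Finset H) (n : ℕ) : #(c.lVals (A ^ n)) ≤ #(c.lVals A) ^ n := by
  induction n with
  | zero =>
    have hsub : c.lVals (A ^ 0) ⊆ {1} := fun g hg ↦ by
      obtain ⟨t, ht, x, rfl⟩ := mem_lVals.1 hg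
      simp [Finset.mem_one.1 ht, c.l_one]
    exact Finset.card_le_card hsub
  | succ n ih =>
    rw [pow_succ, pow_succ]
    exact (card_lVals_mul_le _ _).trans (Nat.mul_le_mul_right _ ih)

lemma card_edgeBoundary_shape_le (K : Finset G) (T : Finset H) (x : X) :
    #(edgeBoundary K (c.shape T x)) ≤ #K * #(edgeBoundary (c.kVals K) T) := by
  rw [card_edgeBoundary, ← smul_eq_mul]
  refine Finset.sum_le_card_nsmul _ _ _ fun g hg ↦ ?_
  refine le_trans ?_ (card_filter_exists_mul_notMem_le (c.kVals K) T)
  rw [← Finset.card_image_of_injective _ (c.l_injective x)]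
  refine Finset.card_le_card fun f hf ↦ ?_
  obtain ⟨hf, hgf⟩ := Finset.mem_filter.1 hf
  obtain ⟨t, ht, rfl⟩ := Finset.mem_image.1 hf
  refine Finset.mem_image_of_mem _ (Finset.mem_filter.2
    ⟨ht, c.k g (c.l t x • x), k_mem_kVals hg _, fun hmem ↦ hgf ?_⟩)
  rw [← c.l_k g (c.l t x • x), ← c.l_mul]
  exact l_mem_shape.2 hmem

lemma eventually_forall_shape {p : Finset G → Prop} (hp : ∀ᶠ A in folner G, p A) :
    ∀ᶠ T in folner H, ∀ x, p (c.shape T x) := by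
  obtain ⟨K, hK⟩ := eventually_folner_iff.1 hp
  obtain ⟨δ, hδ, hp⟩ := (hasBasis_invariantFilter K).eventually_iff.1 hK
  filter_upwards [eventually_folner_isInvariant (c.kVals K) (δ := δ / (#K + 1)) (by positivity),
    folner_le ∅ (eventually_nonempty_invariantFilter ∅)] with T hT hne x
  refine hp ⟨hne.image _, ?_⟩
  calc (#(edgeBoundary K (c.shape T x)) : ℝ) ≤ #K * #(edgeBoundary (c.kVals K) T) :=
        mod_cast card_edgeBoundary_shape_le K T x
    _ ≤ #K * (δ / (#K + 1) * #T) := by gcongr; exact hT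
    _ = #K / (#K + 1) * (δ * #T) := by ring
    _ ≤ 1 * (δ * #T) := by
        gcongr
        exact div_le_one_of_le₀ (by linarith) (by positivity)
    _ = δ * #(c.shape T x) := by rw [one_mul, card_shape]

end OrbitCocycle

section Connectivity

variable {H : Type*} [Group H] {S T : Finset H} {u v : H}

/-- A step of a walk inside `T` on the left Cayley graph of `S`. -/
def Step (S T : Finset H) (u v : H) : Prop := u ∈ T ∧ v ∈ T ∧ ∃ s ∈ S, v = s * u

/-- The existence of a walk from `u` to `v` inside `T` on the left Cayley graph of `S`. -/
def Reach (S T : Finset H) : H → H → Prop := Relation.ReflTransGen (Step S T)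

lemma Reach.exists_step {P : H → Prop} (h : Reach S T u v) (hu : P u) (hv : ¬ P v) :
    ∃ a b, Step S T a b ∧ P a ∧ ¬ P b := by
  by_contra! hcon
  exact hv (Relation.ReflTransGen.rec hu (fun _ hab ha ↦ hcon _ _ hab ha) h)

variable [DecidableEq H]

lemma Step.symm (hS : S⁻¹ = S) (h : Step S T u v) : Step S T v u := by
  obtain ⟨hu, hv, s, hs, rfl⟩ := h
  exact ⟨hv, hu, s⁻¹, hS ▸ Finset.inv_mem_inv hs, by simp⟩

lemma Reach.symm (hS : S⁻¹ = S) (h : Reach S T u v) : Reach S T v u :=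
  have : Std.Symm (Step S T) := ⟨fun _ _ ↦ Step.symm hS⟩
  Relation.ReflTransGen.stdSymm.symm _ _ h

lemma reach_mul_of_op_smul_subset (h1 : 1 ∈ S) {n : ℕ} (h : S ^ n <• u ⊆ T) {w : H}
    (hw : w ∈ S ^ n) : Reach S T u (w * u) := by
  induction n generalizing w with
  | zero =>
    rw [Finset.mem_one.1 hw, one_mul]
    exact Relation.ReflTransGen.refl
  | succ n ih =>
    have hsub : S ^ n <• u ⊆ T :=
      (Finset.smul_finset_subset_smul_finset (Finset.pow_subset_pow_right h1 n.le_succ)).trans h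
    have hwT : w * u ∈ T := h (Finset.smul_mem_smul_finset hw)
    obtain ⟨s, hs, v, hv, rfl⟩ := Finset.mem_mul.1 (pow_succ' S n ▸ hw)
    exact (ih hsub hv).tail ⟨hsub (Finset.smul_mem_smul_finset hv), hwT, s, hs, mul_assoc _ _ _⟩

lemma card_edgeBoundary_add_card_edgeBoundary_sdiff_le (hS : S⁻¹ = S) {A : Finset H} (hAT : A ⊆ T)
    (hA : ∀ a b, Step S T a b → a ∈ A → b ∈ A) :
    #(edgeBoundary S A) + #(edgeBoundary S (T \ A)) ≤ #(edgeBoundary S T) := by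
  rw [← Finset.card_union_of_disjoint]
  · refine Finset.card_le_card (Finset.union_subset (fun p hp ↦ ?_) fun p hp ↦ ?_) <;>
      obtain ⟨hpS, hpA, hp⟩ := mem_edgeBoundary.1 hp
    · exact mem_edgeBoundary.2 ⟨hpS, hAT hpA, fun hpT ↦ hp
        (hA _ _ ⟨hAT hpA, hpT, _, hpS, rfl⟩ hpA)⟩
    · obtain ⟨hpT, hpA⟩ := Finset.mem_sdiff.1 hpA
      exact mem_edgeBoundary.2 ⟨hpS, hpT, fun hT ↦ hp (Finset.mem_sdiff.2 ⟨hT, fun h ↦ hpA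
        (hA _ _ (Step.symm hS ⟨hpT, hT, _, hpS, rfl⟩) h)⟩)⟩
  · refine Finset.disjoint_left.2 fun p hp hp' ↦ ?_
    exact (Finset.mem_sdiff.1 (mem_edgeBoundary.1 hp').2.1).2 (mem_edgeBoundary.1 hp).2.1

lemma exists_isInvariant_reach (hS : S⁻¹ = S) {δ : ℝ} (hne : T.Nonempty) (hT : IsInvariant S δ T) :
    ∃ T : Finset H, 1 ∈ T ∧ IsInvariant S δ T ∧ ∀ t ∈ T, Reach S T 1 t := by
  induction hn : #T using Nat.strong_induction_on generalizing T with
  | _ n ih =>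
    obtain ⟨u, hu⟩ := hne
    wlog hu1 : u = 1 generalizing T u
    · refine this (T := T <• u⁻¹) ?_ (by simp [hn]) 1 (mem_op_smul_finset.2 (by simpa)) rfl
      simpa only [IsInvariant, card_edgeBoundary_op_smul, Finset.card_smul_finset] using hT
    subst hu1
    classical
    let A : Finset H := {t ∈ T | Reach S T 1 t}
    have hAT : A ⊆ T := Finset.filter_subset _ _
    have hA1 : A.Nonempty := ⟨1, Finset.mem_filter.2 ⟨hu, .refl⟩⟩
    by_cases hB : T ⊆ A
    · exact ⟨T, hu, hT, fun t ht ↦ (Finset.mem_filter.1 (hB ht)).2⟩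
    have hcard : #(T \ A) + #A = #T := Finset.card_sdiff_add_card_eq_card hAT
    have hB1 : (T \ A).Nonempty := Finset.sdiff_nonempty.2 hB
    have hsum := card_edgeBoundary_add_card_edgeBoundary_sdiff_le hS hAT fun a b hab ha ↦
      Finset.mem_filter.2 ⟨hab.2.1, (Finset.mem_filter.1 ha).2.tail hab⟩
    by_cases hA : IsInvariant S δ A
    · exact ih _ (by have := hB1.card_pos; omega) hA1 hA rfl
    · refine ih _ (by have := hA1.card_pos; omega) hB1 ?_ rfl
      rify at hsum hcard
      rw [IsInvariant, ← hcard] at hT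
      rw [IsInvariant] at hA ⊢
      linarith

lemma frequently_invariantFilter_reach (hS : S⁻¹ = S) [(invariantFilter S).NeBot] :
    ∃ᶠ T in invariantFilter S, 1 ∈ T ∧ ∀ t ∈ T, Reach S T 1 t := by
  refine (hasBasis_invariantFilter S).frequently_iff.2 fun δ hδ ↦ ?_
  obtain ⟨T₀, hne, hT₀⟩ :=
    ((eventually_nonempty_invariantFilter S).and (eventually_isInvariant S hδ)).exists
  obtain ⟨T, h1, hT, hreach⟩ := exists_isInvariant_reach hS hne hT₀
  exact ⟨T, ⟨⟨1, h1⟩, hT⟩, h1, hreach⟩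

end Connectivity

section Powers

variable {H : Type*} [Group H] [DecidableEq H] {S T : Finset H}

lemma card_edgeBoundary_mul_le (A B T : Finset H) :
    #(edgeBoundary (A * B) T) ≤ #B * #(edgeBoundary A T) + #A * #(edgeBoundary B T) := by
  have hfilter (a b : H) :
      #{t ∈ T | a * b * t ∉ T} ≤ #{t ∈ T | a * t ∉ T} + #{t ∈ T | b * t ∉ T} := by
    rw [← Finset.card_smul_finset b⁻¹ {t ∈ T | a * t ∉ T}]
    refine (Finset.card_le_card fun t ht ↦ ?_).trans (Finset.card_union_le _ _)
    simp only [Finset.mem_filter, Finset.mem_union, Finset.mem_inv_smul_finset_iff, smul_eq_mul,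
      mul_assoc] at ht ⊢
    tauto
  calc #(edgeBoundary (A * B) T) = ∑ k ∈ A * B, #{t ∈ T | k * t ∉ T} := card_edgeBoundary _ _
    _ ≤ ∑ p ∈ A ×ˢ B, #{t ∈ T | p.1 * p.2 * t ∉ T} :=
        Finset.sum_image_le_of_nonneg fun _ _ ↦ Nat.zero_le _
    _ ≤ ∑ p ∈ A ×ˢ B, (#{t ∈ T | p.1 * t ∉ T} + #{t ∈ T | p.2 * t ∉ T}) :=
        Finset.sum_le_sum fun p _ ↦ hfilter p.1 p.2
    _ = #B * #(edgeBoundary A T) + #A * #(edgeBoundary B T) := by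
        simp only [card_edgeBoundary, Finset.sum_add_distrib, Finset.sum_product, Finset.sum_const,
          smul_eq_mul, Finset.mul_sum]

lemma inf_invariantFilter_le_mul (A B : Finset H) :
    invariantFilter A ⊓ invariantFilter B ≤ invariantFilter (A * B) := by
  refine (hasBasis_invariantFilter (A * B)).ge_iff.2 fun δ hδ ↦ ?_
  obtain ⟨ε, hε0, hε⟩ : ∃ ε : ℝ, 0 < ε ∧ (#A + #B + 1) * ε = δ :=
    ⟨δ / (#A + #B + 1), by positivity, by field_simp⟩
  filter_upwards [(eventually_nonempty_invariantFilter A).filter_mono inf_le_left,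
    (eventually_isInvariant A hε0).filter_mono inf_le_left,
    (eventually_isInvariant B hε0).filter_mono inf_le_right]
    with T hne hA hB
  refine ⟨hne, ?_⟩
  calc (#(edgeBoundary (A * B) T) : ℝ)
      ≤ #B * #(edgeBoundary A T) + #A * #(edgeBoundary B T) :=
        mod_cast card_edgeBoundary_mul_le A B T
    _ ≤ #B * (ε * #T) + #A * (ε * #T) := by gcongr <;> assumption
    _ ≤ (#A + #B + 1) * ε * #T := by
        linarith [mul_nonneg hε0.le (Nat.cast_nonneg (α := ℝ) #T)]
    _ = δ * #T := by rw [hε]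

lemma invariantFilter_le_pow (S : Finset H) (n : ℕ) :
    invariantFilter S ≤ invariantFilter (S ^ n) := by
  induction n with
  | zero =>
    refine (hasBasis_invariantFilter _).ge_iff.2 fun δ hδ ↦ ?_
    filter_upwards [eventually_nonempty_invariantFilter S] with T hT
    have hempty : edgeBoundary (S ^ 0) T = ∅ := by
      ext p
      simp +contextual [mem_edgeBoundary]
    exact ⟨hT, by rw [IsInvariant, hempty, Finset.card_empty, Nat.cast_zero]; positivity⟩
  | succ n ih =>
    rw [pow_succ]
    exact (le_inf ih le_rfl).trans (inf_invariantFilter_le_mul _ _)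

lemma card_mul_sdiff_le (B T : Finset H) : #((B * T) \ T) ≤ #(edgeBoundary B T) := by
  refine (Finset.card_le_card fun g hg ↦ ?_).trans
    (Finset.card_image_le (f := fun p : H × H ↦ p.1 * p.2))
  obtain ⟨hg, hgT⟩ := Finset.mem_sdiff.1 hg
  obtain ⟨b, hb, t, ht, rfl⟩ := Finset.mem_mul.1 hg
  exact Finset.mem_image.2 ⟨(b, t), mem_edgeBoundary.2 ⟨hb, ht, hgT⟩, rfl⟩

lemma card_mul_card_le_of_pairwiseDisjoint {B Z U : Finset H}
    (hZ : (Z : Set H).PairwiseDisjoint fun z ↦ B <• z) (hU : ∀ z ∈ Z, B <• z ⊆ U) :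
    #B * #Z ≤ #U :=
  calc #B * #Z = #(Z.biUnion fun z ↦ B <• z) := by
        rw [Finset.card_biUnion hZ]
        simp [mul_comm]
    _ ≤ #U := Finset.card_le_card (Finset.biUnion_subset.2 hU)

lemma eventually_card_mul_card_le_two_mul (B : Finset H) :
    ∀ᶠ T in invariantFilter B, ∀ Z : Finset H, Z ⊆ T →
      (Z : Set H).PairwiseDisjoint (fun z ↦ B <• z) →
      #B * #Z ≤ 2 * #T := by
  filter_upwards [eventually_isInvariant B one_pos] with T hT Z hZT hZ
  have hT : #(edgeBoundary B T) ≤ #T := by simpa [IsInvariant] using hT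
  calc #B * #Z ≤ #(T ∪ (B * T)) :=
        card_mul_card_le_of_pairwiseDisjoint hZ fun z hz ↦
          (Finset.op_smul_finset_subset_mul (hZT hz)).trans Finset.subset_union_right
    _ ≤ #T + #((B * T) \ T) := by
        rw [← Finset.union_sdiff_self_eq_union]
        exact Finset.card_union_le _ _
    _ ≤ 2 * #T := by have := card_mul_sdiff_le B T; omega

lemma card_mul_card_le_of_pairwise_not_reach (h1 : 1 ∈ S) (hS : S⁻¹ = S) {D : Finset H} (n : ℕ)
    (hDT : ∀ d ∈ D, S ^ n <• d ⊆ T) (hD : (D : Set H).Pairwise fun d d' ↦ ¬ Reach S T d d') :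
    #(S ^ n) * #D ≤ #T := by
  refine card_mul_card_le_of_pairwiseDisjoint (fun d hd d' hd' hne ↦ ?_) hDT
  refine Finset.disjoint_left.2 fun g hg hg' ↦ hD hd hd' hne ?_
  obtain ⟨w, hw, rfl⟩ := Finset.mem_smul_finset.1 hg
  obtain ⟨w', hw', h : w' * d' = w * d⟩ := Finset.mem_smul_finset.1 hg'
  have hreach := reach_mul_of_op_smul_subset h1 (hDT d' hd') hw'
  exact (reach_mul_of_op_smul_subset h1 (hDT d hd) hw).trans (h ▸ hreach.symm hS)

lemma eventually_card_le_of_pairwise_not_reach (h1 : 1 ∈ S) (hS : S⁻¹ = S)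
    (hgrow : ∀ N : ℕ, ∃ n, N ≤ #(S ^ n)) {ε : ℝ} (hε : 0 < ε) :
    ∀ᶠ T in invariantFilter S, ∀ D : Finset H, D ⊆ T →
      (D : Set H).Pairwise (fun d d' ↦ ¬ Reach S T d d') → (#D : ℝ) ≤ ε * #T := by
  obtain ⟨N, hN⟩ := exists_nat_ge (2 / ε)
  obtain ⟨n, hn⟩ := hgrow N
  filter_upwards [invariantFilter_le_pow S n (eventually_isInvariant _ (half_pos hε))]
    with T hT D hDT hD
  have hinterior : (#{d ∈ D | S ^ n <• d ⊆ T} : ℝ) ≤ ε / 2 * #T := by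
    have hle : #(S ^ n) * #{d ∈ D | S ^ n <• d ⊆ T} ≤ #T :=
      card_mul_card_le_of_pairwise_not_reach h1 hS n (fun d hd ↦ (Finset.mem_filter.1 hd).2)
        (hD.mono (by simp +contextual [Set.subset_def]))
    have hbig : 2 / ε ≤ #(S ^ n) := hN.trans (mod_cast hn)
    rify at hle
    rw [div_le_iff₀ hε] at hbig
    nlinarith [Nat.cast_nonneg (α := ℝ) #{d ∈ D | S ^ n <• d ⊆ T}]
  have hboundary : (#{d ∈ D | ¬ S ^ n <• d ⊆ T} : ℝ) ≤ ε / 2 * #T := by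
    refine le_trans (mod_cast Finset.card_le_card fun d hd ↦ ?_)
      ((Nat.cast_le.2 (card_filter_exists_mul_notMem_le (S ^ n) T)).trans hT)
    obtain ⟨hdD, hd⟩ := Finset.mem_filter.1 hd
    obtain ⟨_, hwd, hwT⟩ := Finset.not_subset.1 hd
    obtain ⟨w, hw, rfl⟩ := Finset.mem_smul_finset.1 hwd
    exact Finset.mem_filter.2 ⟨hDT hdD, w, hw, hwT⟩
  rw [← Finset.card_filter_add_card_filter_not (s := D) fun d ↦ S ^ n <• d ⊆ T]
  push_cast
  linarith

end Powers

namespace OrbitCocycle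

variable {G H X Y : Type*} [Group G] [TopologicalSpace X] [MulAction G X]
  [Group H] [TopologicalSpace Y] [MulAction H Y]

/-- At most `N` functions on `Z` arise by restricting the functions `t ↦ l t x` with `x ∈ X`. -/
def RestrictionsLE (c : OrbitCocycle G H X Y) (Z : Finset H) (N : ℕ) : Prop :=
  ∃ 𝒵 : Finset (H → G), #𝒵 ≤ N ∧ ∀ x, ∃ ζ ∈ 𝒵, ∀ z ∈ Z, c.l z x = ζ z

variable {c : OrbitCocycle G H X Y}

lemma RestrictionsLE.mono {Z : Finset H} {N N' : ℕ} (h : c.RestrictionsLE Z N) (hN : N ≤ N') :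
    c.RestrictionsLE Z N' :=
  h.imp fun _ h𝒵 ↦ ⟨h𝒵.1.trans hN, h𝒵.2⟩

variable [DecidableEq G] [DecidableEq H]

lemma RestrictionsLE.insert {Z A : Finset H} {N : ℕ} (h : c.RestrictionsLE Z N) {v : H}
    (hv : v ∈ A * Z) : c.RestrictionsLE (insert v Z) (N * #(c.lVals A)) := by
  classical
  obtain ⟨𝒵, hcard, h𝒵⟩ := h
  obtain ⟨w, hw, z, hz, rfl⟩ := Finset.mem_mul.1 hv
  refine ⟨Finset.image₂ (fun ζ g ↦ Function.update ζ (w * z) (g * ζ z)) 𝒵 (c.lVals A),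
    (Finset.card_image₂_le _ _ _).trans (Nat.mul_le_mul_right _ hcard), fun x ↦ ?_⟩
  obtain ⟨ζ, hζ, hx⟩ := h𝒵 x
  refine ⟨_, Finset.mem_image₂_of_mem hζ (l_mem_lVals hw (c.l z x • x)), fun u hu ↦ ?_⟩
  rcases eq_or_ne u (w * z) with rfl | hne
  · rw [Function.update_self, c.l_mul, hx z hz]
  · rw [Function.update_of_ne hne, hx u (Finset.mem_of_mem_insert_of_ne hu hne)]

/-- Two sets of sample points in `T` at which the cocycle is recorded: the points of `D` lie in
distinct `S`-components of `T`, the points of `Z` are separated within the `S`-components, and the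
number of ways to record the cocycle at these points is controlled by `#Z` and `#D`. A new point
`v` is always reached by a short word from an old one, in the generators `S` for `v ∈ Z` but with
one jump by a generator in `S₂` for `v ∈ D`; this is the origin of the two factors in the bound. -/
structure IsPartialNet (c : OrbitCocycle G H X Y) (S S₂ T : Finset H) (r : ℕ)
    (Z D : Finset H) : Prop where
  one_mem : 1 ∈ D
  left_subset : Z ⊆ T
  right_subset : D ⊆ T
  pairwiseDisjoint : (Z : Set H).PairwiseDisjoint fun z ↦ S ^ r <• z
  pairwise_not_reach : (D : Set H).Pairwise fun d d' ↦ ¬ Reach S T d d'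
  restrictionsLE : c.RestrictionsLE (Z ∪ D)
    (#(c.lVals S) ^ ((2 * r + 1) * #Z) * (#(c.lVals S₂) * #(c.lVals S) ^ (2 * r)) ^ #D)

namespace IsPartialNet

variable {S S₂ T Z D : Finset H} {r : ℕ} {v : H}

lemma initial (hS : S.Nonempty) (hS₂ : S₂.Nonempty) (hT : 1 ∈ T) :
    c.IsPartialNet S S₂ T r ∅ {1} := by
  refine ⟨by simp, by simp, by simpa, by simp, by simp, ?_⟩
  rcases isEmpty_or_nonempty X with hX | hX
  · exact ⟨∅, by simp, isEmptyElim⟩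
  refine ⟨{fun _ ↦ 1}, ?_, fun x ↦ ⟨_, Finset.mem_singleton_self _, by simp [l_one]⟩⟩
  have hpos := (c.lVals_nonempty hS).card_pos
  have hpos₂ := (c.lVals_nonempty hS₂).card_pos
  rw [Finset.card_singleton]
  exact Nat.one_le_iff_ne_zero.2 (by positivity)

lemma insert_left (h : c.IsPartialNet S S₂ T r Z D) (hS : S⁻¹ = S) (hvT : v ∈ T)
    (hv : v ∈ S ^ (2 * r + 1) * (Z ∪ D)) (hvZ : v ∉ S ^ (2 * r) * Z) (hvZ' : v ∉ Z) :
    c.IsPartialNet S S₂ T r (insert v Z) D where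
  one_mem := h.one_mem
  left_subset := Finset.insert_subset hvT h.left_subset
  right_subset := h.right_subset
  pairwiseDisjoint := by
    rw [Finset.coe_insert]
    refine h.pairwiseDisjoint.insert fun z hz _ ↦ Finset.disjoint_left.2 fun g hgv hgz ↦ hvZ ?_
    obtain ⟨b, hb, rfl⟩ := Finset.mem_smul_finset.1 hgv
    obtain ⟨b', hb', hbz : b' * z = b * v⟩ := Finset.mem_smul_finset.1 hgz
    have hbinv : b⁻¹ ∈ S ^ r := by
      rw [← hS, inv_pow]
      exact Finset.inv_mem_inv hb
    rw [eq_inv_mul_of_mul_eq hbz.symm, ← mul_assoc, two_mul, pow_add]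
    exact Finset.mul_mem_mul (Finset.mul_mem_mul hbinv hb') hz
  pairwise_not_reach := h.pairwise_not_reach
  restrictionsLE := by
    rw [Finset.insert_union]
    refine (h.restrictionsLE.insert hv).mono
      ((Nat.mul_le_mul_left _ (card_lVals_pow_le S _)).trans_eq ?_)
    rw [Finset.card_insert_of_notMem hvZ']
    ring

lemma insert_right (h : c.IsPartialNet S S₂ T r Z D) (hS : S⁻¹ = S) (hvT : v ∈ T)
    (hv : v ∈ S₂ * S ^ (2 * r) * (Z ∪ D)) (hvD : ∀ d ∈ D, ¬ Reach S T d v) :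
    c.IsPartialNet S S₂ T r Z (insert v D) where
  one_mem := Finset.mem_insert_of_mem h.one_mem
  left_subset := h.left_subset
  right_subset := Finset.insert_subset hvT h.right_subset
  pairwiseDisjoint := h.pairwiseDisjoint
  pairwise_not_reach := by
    rw [Finset.coe_insert]
    exact h.pairwise_not_reach.insert fun d hd _ ↦
      ⟨fun hvd ↦ hvD d hd (hvd.symm hS), hvD d hd⟩
  restrictionsLE := by
    rw [Finset.union_insert]
    refine (h.restrictionsLE.insert hv).mono ((Nat.mul_le_mul_left _ ((card_lVals_mul_le _ _).trans
      (Nat.mul_le_mul_left _ (card_lVals_pow_le S _)))).trans_eq ?_)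
    rw [Finset.card_insert_of_notMem fun hmem ↦ hvD v hmem Relation.ReflTransGen.refl]
    ring

end IsPartialNet

lemma exists_maximal_isPartialNet {S S₂ T : Finset H} (hS : S.Nonempty)
    (hS₂ : S₂.Nonempty) (hT : 1 ∈ T) (r : ℕ) : ∃ Z D : Finset H, c.IsPartialNet S S₂ T r Z D ∧
      ∀ Z' D', c.IsPartialNet S S₂ T r Z' D' → #Z' + #D' ≤ #Z + #D := by
  classical
  have hne : {p ∈ T.powerset ×ˢ T.powerset | c.IsPartialNet S S₂ T r p.1 p.2}.Nonempty :=
    ⟨(∅, {1}), by simpa [hT] using IsPartialNet.initial hS hS₂ hT⟩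
  obtain ⟨⟨Z, D⟩, hZD, hmax⟩ := Finset.exists_max_image _ (fun p ↦ #p.1 + #p.2) hne
  refine ⟨Z, D, (Finset.mem_filter.1 hZD).2, fun Z' D' h ↦ hmax (Z', D') ?_⟩
  simp [h, h.left_subset, h.right_subset]

lemma exists_isPartialNet_spanning {S S₂ T : Finset H} (h1 : 1 ∈ S) (hS : S⁻¹ = S)
    (hS₂ : S₂.Nonempty) (hT1 : 1 ∈ T) (hT : ∀ t ∈ T, Reach S₂ T 1 t) (r : ℕ) :
    ∃ Z D : Finset H, c.IsPartialNet S S₂ T r Z D ∧ (∀ t ∈ T, ∃ d ∈ D, Reach S T d t) ∧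
      T ⊆ S ^ (2 * r) * (Z ∪ D) := by
  obtain ⟨Z, D, hZD, hmax⟩ := c.exists_maximal_isPartialNet ⟨1, h1⟩ hS₂ hT1 r
  have hself : Z ∪ D ⊆ S ^ (2 * r) * (Z ∪ D) :=
    Finset.subset_mul_right _ (Finset.one_mem_pow h1)
  have hnear : ∀ t, (∃ d ∈ D, Reach S T d t) → t ∈ S ^ (2 * r) * (Z ∪ D) := by
    rintro t ⟨d, hd, hdt⟩
    by_contra ht
    obtain ⟨u, _, ⟨-, hvT, s, hs, rfl⟩, hu, hv⟩ :=
      hdt.exists_step (hself (Finset.mem_union_right _ hd)) ht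
    have hvZ : s * u ∉ Z := fun h ↦ hv (hself (Finset.mem_union_left _ h))
    have hsu : s * u ∈ S ^ (2 * r + 1) * (Z ∪ D) := by
      rw [pow_succ', mul_assoc]
      exact Finset.mul_mem_mul hs hu
    have hnew := hmax _ _ (hZD.insert_left hS hvT hsu
      (fun h ↦ hv (Finset.mul_subset_mul_left Finset.subset_union_left h)) hvZ)
    rw [Finset.card_insert_of_notMem hvZ] at hnew
    omega
  have hreach : ∀ t ∈ T, ∃ d ∈ D, Reach S T d t := by
    intro t ht
    by_contra hcon
    obtain ⟨u, _, ⟨-, hvT, s, hs, rfl⟩, hu, hv⟩ :=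
      (hT t ht).exists_step (P := fun t ↦ ∃ d ∈ D, Reach S T d t)
        ⟨1, hZD.one_mem, Relation.ReflTransGen.refl⟩ hcon
    have hvD : s * u ∉ D := fun h ↦ hv ⟨_, h, Relation.ReflTransGen.refl⟩
    have hsu : s * u ∈ S₂ * S ^ (2 * r) * (Z ∪ D) := by
      rw [mul_assoc]
      exact Finset.mul_mem_mul hs (hnear u hu)
    have hnew := hmax _ _ (hZD.insert_right hS hvT hsu fun d hd h ↦ hv ⟨d, hd, h⟩)
    rw [Finset.card_insert_of_notMem hvD] at hnew
    omega
  exact ⟨Z, D, hZD, hreach, fun t ht ↦ hnear t (hreach t ht)⟩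

end OrbitCocycle

lemma card_filter_powerset_card_le_le_exp {α : Type*} (M : Finset α) (q : ℝ) {y : ℝ}
    (hy : 0 ≤ y) :
    (#{B ∈ M.powerset | (#B : ℝ) ≤ q} : ℝ) ≤ Real.exp (y * q + #M * Real.exp (-y)) := by
  have hmarkov : #{B ∈ M.powerset | (#B : ℝ) ≤ q} * Real.exp (-(y * q)) ≤
      ∑ B ∈ M.powerset, Real.exp (-y) ^ #B := by
    rw [← nsmul_eq_mul]
    refine (Finset.card_nsmul_le_sum _ _ _ fun B hB ↦ ?_).trans
      (Finset.sum_le_sum_of_subset_of_nonneg (Finset.filter_subset _ _) fun _ _ _ ↦ by positivity)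
    rw [← Real.exp_nat_mul, Real.exp_le_exp]
    linarith [mul_le_mul_of_nonneg_left (Finset.mem_filter.1 hB).2 hy]
  have hbinom : ∑ B ∈ M.powerset, Real.exp (-y) ^ #B ≤ Real.exp (#M * Real.exp (-y)) := by
    calc ∑ B ∈ M.powerset, Real.exp (-y) ^ #B = (Real.exp (-y) + 1) ^ #M := by
          simp [← Finset.sum_pow_mul_eq_add_pow]
      _ ≤ Real.exp (Real.exp (-y)) ^ #M := by
          gcongr
          exact Real.add_one_le_exp _
      _ = Real.exp (#M * Real.exp (-y)) := (Real.exp_nat_mul _ _).symm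
  have hle := hmarkov.trans hbinom
  rw [Real.exp_neg, ← div_eq_mul_inv, div_le_iff₀ (Real.exp_pos _)] at hle
  rwa [add_comm, Real.exp_add]

namespace OrbitCocycle

variable {G H X Y : Type*} [Group G] [TopologicalSpace X] [MulAction G X]
  [Group H] [TopologicalSpace Y] [MulAction H Y] {c : OrbitCocycle G H X Y}

section Cells

variable [DecidableEq G] {S T D : Finset H} {x x' : X}

lemma shape_subset_of_edgeBoundary_eq (hDT : D ⊆ T) (hD : ∀ t ∈ T, ∃ d ∈ D, Reach S T d t)
    (hxx' : ∀ d ∈ D, c.l d x = c.l d x')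
    (h : edgeBoundary (c.lVals S) (c.shape T x) = edgeBoundary (c.lVals S) (c.shape T x')) :
    c.shape T x ⊆ c.shape T x' := by
  refine Finset.image_subset_iff.2 fun t ht ↦ ?_
  obtain ⟨d, hd, hdt⟩ := hD t ht
  by_contra hnot
  obtain ⟨u, _, ⟨-, hsu, s, hs, rfl⟩, hu, hv⟩ := hdt.exists_step
    (P := fun t ↦ c.l t x ∈ c.shape T x') (hxx' d hd ▸ l_mem_shape.2 (hDT hd)) hnot
  have hmem : (c.l s (c.l u x • x), c.l u x) ∈ edgeBoundary (c.lVals S) (c.shape T x) :=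
    h ▸ mem_edgeBoundary.2 ⟨l_mem_lVals hs _, hu, by rwa [← c.l_mul]⟩
  exact (mem_edgeBoundary.1 hmem).2.2 (by rw [← c.l_mul]; exact l_mem_shape.2 hsu)

lemma shape_eq_of_edgeBoundary_eq (hDT : D ⊆ T) (hD : ∀ t ∈ T, ∃ d ∈ D, Reach S T d t)
    (hxx' : ∀ d ∈ D, c.l d x = c.l d x')
    (h : edgeBoundary (c.lVals S) (c.shape T x) = edgeBoundary (c.lVals S) (c.shape T x')) :
    c.shape T x = c.shape T x' :=
  (shape_subset_of_edgeBoundary_eq hDT hD hxx' h).antisymm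
    (shape_subset_of_edgeBoundary_eq hDT hD (fun d hd ↦ (hxx' d hd).symm) h.symm)

lemma l_eq_of_forall_shape (hD : ∀ t ∈ T, ∃ d ∈ D, Reach S T d t)
    (hxx' : ∀ d ∈ D, c.l d x = c.l d x')
    (hS : ∀ g ∈ c.shape T x, ∀ s ∈ S, c.l s (g • x) = c.l s (g • x')) {t : H} (ht : t ∈ T) :
    c.l t x = c.l t x' := by
  obtain ⟨d, hd, hdt⟩ := hD t ht
  by_contra hne
  obtain ⟨u, _, ⟨hu, -, s, hs, rfl⟩, hux, hsux⟩ :=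
    hdt.exists_step (P := fun t ↦ c.l t x = c.l t x') (hxx' d hd) hne
  exact hsux (by rw [c.l_mul, c.l_mul, hS _ (l_mem_shape.2 hu) s hs, hux])

end Cells

section Count

variable [DecidableEq G] [DecidableEq H] {S R T Z D : Finset H} {q y : ℝ}

lemma exists_finset_shape (hDT : D ⊆ T) (hD : ∀ t ∈ T, ∃ d ∈ D, Reach S T d t) (hDZ : D ⊆ Z)
    (hTZ : T ⊆ R * Z) (hq : ∀ x, (#(edgeBoundary (c.lVals S) (c.shape T x)) : ℝ) ≤ q)
    (hy : 0 ≤ y) (ζ : H → G) :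
    ∃ 𝓕 : Finset (Finset G),
      (#𝓕 : ℝ) ≤ Real.exp (y * q + #(c.lVals S) * (#(c.lVals R) * #Z) * Real.exp (-y)) ∧
      (∀ x, (∀ z ∈ Z, c.l z x = ζ z) → c.shape T x ∈ 𝓕) ∧ ∀ A ∈ 𝓕, ∃ x, c.shape T x = A := by
  classical
  let 𝓕 := {A ∈ (c.lVals T).powerset | ∃ x, (∀ z ∈ Z, c.l z x = ζ z) ∧ c.shape T x = A}
  let M := c.lVals S ×ˢ Finset.image₂ (fun g z ↦ g * ζ z) (c.lVals R) Z
  have hM : #M ≤ #(c.lVals S) * (#(c.lVals R) * #Z) := by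
    rw [Finset.card_product]
    exact Nat.mul_le_mul_left _ (Finset.card_image₂_le _ _ _)
  have hshape (x : X) (hx : ∀ z ∈ Z, c.l z x = ζ z) :
      c.shape T x ⊆ Finset.image₂ (fun g z ↦ g * ζ z) (c.lVals R) Z := by
    refine Finset.image_subset_iff.2 fun t ht ↦ ?_
    obtain ⟨w, hw, z, hz, rfl⟩ := Finset.mem_mul.1 (hTZ ht)
    rw [c.l_mul, hx z hz]
    exact Finset.mem_image₂_of_mem (l_mem_lVals hw _) hz
  have hcard : #𝓕 ≤ #{B ∈ M.powerset | (#B : ℝ) ≤ q} := by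
    refine Finset.card_le_card_of_injOn (edgeBoundary (c.lVals S)) ?_ ?_
    · rintro A hA
      obtain ⟨-, x, hx, rfl⟩ := Finset.mem_filter.1 hA
      refine Finset.mem_filter.2 ⟨Finset.mem_powerset.2 fun p hp ↦ ?_, hq x⟩
      obtain ⟨hp₁, hp₂, -⟩ := mem_edgeBoundary.1 hp
      exact Finset.mem_product.2 ⟨hp₁, hshape x hx hp₂⟩
    · rintro A hA A' hA' hAA'
      obtain ⟨-, x, hx, rfl⟩ := Finset.mem_filter.1 hA
      obtain ⟨-, x', hx', rfl⟩ := Finset.mem_filter.1 hA'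
      exact shape_eq_of_edgeBoundary_eq hDT hD
        (fun d hd ↦ (hx d (hDZ hd)).trans (hx' d (hDZ hd)).symm) hAA'
  refine ⟨𝓕, ?_, fun x hx ↦ Finset.mem_filter.2 ⟨Finset.mem_powerset.2 ?_, x, hx, rfl⟩,
    fun A hA ↦ (Finset.mem_filter.1 hA).2.imp fun _ h ↦ h.2⟩
  · refine (Nat.cast_le.2 hcard).trans ((card_filter_powerset_card_le_le_exp M q hy).trans ?_)
    gcongr
    exact_mod_cast hM
  · exact Finset.image_subset_iff.2 fun t ht ↦ l_mem_lVals ht x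

lemma RestrictionsLE.exists_finset_shape {N : ℕ} (hN : c.RestrictionsLE Z N) (hDT : D ⊆ T)
    (hD : ∀ t ∈ T, ∃ d ∈ D, Reach S T d t) (hDZ : D ⊆ Z) (hTZ : T ⊆ R * Z)
    (hq : ∀ x, (#(edgeBoundary (c.lVals S) (c.shape T x)) : ℝ) ≤ q) (hy : 0 ≤ y) :
    ∃ P : Finset ((_ : H → G) × Finset G),
      (#P : ℝ) ≤ N * Real.exp (y * q + #(c.lVals S) * (#(c.lVals R) * #Z) * Real.exp (-y)) ∧
      (∀ x, ∃ p ∈ P, (∀ z ∈ Z, c.l z x = p.1 z) ∧ c.shape T x = p.2) ∧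
      ∀ p ∈ P, ∃ x, c.shape T x = p.2 := by
  obtain ⟨𝒵, hcard, h𝒵⟩ := hN
  choose 𝓕 h𝓕card h𝓕 h𝓕shape using
    OrbitCocycle.exists_finset_shape (c := c) hDT hD hDZ hTZ hq hy
  refine ⟨𝒵.sigma 𝓕, ?_, fun x ↦ ?_, fun p hp ↦ h𝓕shape _ _ (Finset.mem_sigma.1 hp).2⟩
  · rw [Finset.card_sigma, Nat.cast_sum]
    refine (Finset.sum_le_card_nsmul _ _ _ fun ζ _ ↦ h𝓕card ζ).trans ?_
    rw [nsmul_eq_mul]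
    gcongr
  · obtain ⟨ζ, hζ, hx⟩ := h𝒵 x
    exact ⟨⟨ζ, c.shape T x⟩, Finset.mem_sigma.2 ⟨hζ, h𝓕 ζ x hx⟩, hx, rfl⟩

end Count

section Pullback

variable [DecidableEq G] {𝒱 : Set (Set Y)} {S : Finset H} {U : Set X}

/-- The pullback of a cover of `Y`, refined by the partitions into the level sets of the
functions `l s`, `s ∈ S`. -/
def pullbackCover (c : OrbitCocycle G H X Y) (𝒱 : Set (Set Y)) (S : Finset H) : Set (Set X) :=
  Set.range fun p : 𝒱 × (S → c.lVals S) ↦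
    c.Φ ⁻¹' (p.1 : Set Y) ∩ ⋂ s : S, {x | c.l s x = p.2 s}

lemma isFiniteOpenCover_pullbackCover (h : IsFiniteOpenCover 𝒱) (S : Finset H) :
    IsFiniteOpenCover (c.pullbackCover 𝒱 S) where
  finite := by
    have := h.finite.to_subtype
    exact Set.finite_range _
  isOpen := by
    rintro _ ⟨p, rfl⟩
    exact ((h.isOpen _ p.1.2).preimage c.Φ.continuous).inter
      (isOpen_iInter_of_finite fun s ↦ c.isOpen_l _ _)
  cover := Set.eq_univ_of_forall fun x ↦ by
    obtain ⟨V, hV, hxV⟩ : c.Φ x ∈ ⋃₀ 𝒱 := h.cover ▸ Set.mem_univ _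
    exact ⟨_, ⟨(⟨V, hV⟩, fun s ↦ ⟨c.l s x, l_mem_lVals s.2 x⟩), rfl⟩, hxV, by simp⟩

lemma exists_subset_preimage_of_mem_pullbackCover (hU : U ∈ c.pullbackCover 𝒱 S) :
    ∃ V ∈ 𝒱, U ⊆ c.Φ ⁻¹' V := by
  obtain ⟨p, rfl⟩ := hU
  exact ⟨p.1, p.1.2, Set.inter_subset_left⟩

lemma l_eq_of_mem_pullbackCover (hU : U ∈ c.pullbackCover 𝒱 S) {s : H} (hs : s ∈ S) {x x' : X}
    (hx : x ∈ U) (hx' : x' ∈ U) : c.l s x = c.l s x' := by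
  obtain ⟨p, rfl⟩ := hU
  exact (Set.mem_iInter.1 hx.2 ⟨s, hs⟩).trans (Set.mem_iInter.1 hx'.2 ⟨s, hs⟩).symm

lemma exists_mem_coverJoin_of_agree {T D : Finset H} (hD : ∀ t ∈ T, ∃ d ∈ D, Reach S T d t)
    {x₀ : X} {U : G → Set X} (hU : ∀ g ∈ c.shape T x₀, U g ∈ c.pullbackCover 𝒱 S)
    (hx₀ : ∀ g ∈ c.shape T x₀, g • x₀ ∈ U g) :
    ∃ W ∈ coverJoin 𝒱 T, ∀ x, (∀ d ∈ D, c.l d x₀ = c.l d x) →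
      (∀ g ∈ c.shape T x₀, g • x ∈ U g) → c.Φ x ∈ W := by
  choose! V hV hUV using fun g hg ↦ exists_subset_preimage_of_mem_pullbackCover (hU g hg)
  refine ⟨_, ⟨fun t ↦ V (c.l t x₀), fun t ht ↦ hV _ (l_mem_shape.2 ht), rfl⟩,
    fun x hx hxU ↦ mem_iInter_inv_smul.2 fun t ht ↦ ?_⟩
  have hl : c.l t x₀ = c.l t x := l_eq_of_forall_shape hD hx
    (fun g hg s hs ↦ l_eq_of_mem_pullbackCover (hU g hg) hs (hx₀ g hg) (hxU g hg)) ht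
  rw [← c.Φ_l, ← hl]
  exact hUV _ (l_mem_shape.2 ht) (hxU _ (l_mem_shape.2 ht))

end Pullback

lemma minSubcover_coverJoin_le [DecidableEq G] [DecidableEq H] {𝒱 : Set (Set Y)}
    (h𝒱 : IsFiniteOpenCover 𝒱) {S R T Z D : Finset H} {N : ℕ} {q y b : ℝ}
    (hN : c.RestrictionsLE Z N) (hDT : D ⊆ T) (hD : ∀ t ∈ T, ∃ d ∈ D, Reach S T d t)
    (hDZ : D ⊆ Z) (hTZ : T ⊆ R * Z)
    (hq : ∀ x, (#(edgeBoundary (c.lVals S) (c.shape T x)) : ℝ) ≤ q) (hy : 0 ≤ y)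
    (hb : ∀ x, Real.log (minSubcover (coverJoin (c.pullbackCover 𝒱 S) (c.shape T x))) ≤ b) :
    (minSubcover (coverJoin 𝒱 T) : ℝ) ≤
      N * Real.exp (y * q + #(c.lVals S) * (#(c.lVals R) * #Z) * Real.exp (-y) + b) := by
  obtain ⟨P, hPcard, hP, hPshape⟩ := hN.exists_finset_shape hDT hD hDZ hTZ hq hy
  choose U hU hUcov using
    (isFiniteOpenCover_pullbackCover (c := c) h𝒱 S).exists_subcover_coverJoin (G := G)
  let n : P → ℕ := fun p ↦ minSubcover (coverJoin (c.pullbackCover 𝒱 S) p.1.2)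
  have hcover : minSubcover (coverJoin 𝒱 T) ≤ Nat.card ((p : P) × Fin (n p)) := by
    refine minSubcover_le_of_refine (fun i : (p : P) × Fin (n p) ↦
      {v | ∃ x, c.Φ x = v ∧ ((∀ z ∈ Z, c.l z x = i.1.1.1 z) ∧ c.shape T x = i.1.1.2) ∧
        ∀ g ∈ i.1.1.2, g • x ∈ U _ i.2 g}) (fun v ↦ ?_) ?_
    · obtain ⟨p, hp, hxp⟩ := hP (c.Φ.symm v)
      obtain ⟨i, hi⟩ := hUcov p.2 (c.Φ.symm v)
      exact ⟨⟨⟨p, hp⟩, i⟩, _, c.Φ.apply_symm_apply v, hxp, hi⟩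
    · rintro ⟨⟨⟨ζ, A⟩, hp⟩, i⟩ _ ⟨x₀, -, ⟨hx₀, rfl⟩, hx₀U⟩
      obtain ⟨W, hW, hxW⟩ := exists_mem_coverJoin_of_agree hD (hU _ i) hx₀U
      refine ⟨W, hW, ?_⟩
      rintro _ ⟨x, rfl, ⟨hx, -⟩, hxU⟩
      exact hxW x (fun d hd ↦ (hx₀ d (hDZ hd)).trans (hx d (hDZ hd)).symm) hxU
  have hn (p : P) : (n p : ℝ) ≤ Real.exp b := by
    obtain ⟨x, hx⟩ := hPshape p.1 p.2
    exact (Real.le_exp_log _).trans (Real.exp_le_exp.2 (by simpa only [hx] using hb x))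
  calc (minSubcover (coverJoin 𝒱 T) : ℝ) ≤ Nat.card ((p : P) × Fin (n p)) := mod_cast hcover
    _ = ∑ p : P, (n p : ℝ) := by simp
    _ ≤ #P * Real.exp b := by simpa using Finset.sum_le_card_nsmul Finset.univ _ _ fun p _ ↦ hn p
    _ ≤ _ := by
        rw [Real.exp_add _ b, ← mul_assoc]
        gcongr

end OrbitCocycle

lemma log_natCast_le_log_add {k N : ℕ} {u : ℝ} (hu : 0 ≤ u) (h : (k : ℝ) ≤ N * Real.exp u) :
    Real.log k ≤ Real.log N + u := by
  rcases k.eq_zero_or_pos with rfl | hk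
  · simpa using add_nonneg (Real.log_natCast_nonneg N) hu
  · have hk : (0 : ℝ) < k := mod_cast hk
    have hN : (N : ℝ) ≠ 0 := left_ne_zero_of_mul (hk.trans_le h).ne'
    simpa [Real.log_mul hN (Real.exp_pos u).ne'] using Real.log_le_log hk h

lemma mul_le_mul_of_le_div_add_one {x C ε t : ℝ} (hC : 0 ≤ C) (hε : 0 ≤ ε) (ht : 0 ≤ t)
    (h : x ≤ ε / (C + 1) * t) : x * C ≤ ε * t := by
  calc x * C ≤ ε / (C + 1) * t * C := by gcongr
    _ = C / (C + 1) * (ε * t) := by ring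
    _ ≤ 1 * (ε * t) := by
        gcongr
        exact div_le_one_of_le₀ (by linarith) (by positivity)
    _ = ε * t := one_mul _

lemma exists_nonneg_mul_exp_neg_le (A : ℝ) {ε : ℝ} (hε : 0 < ε) :
    ∃ y : ℝ, 0 ≤ y ∧ A * Real.exp (-y) ≤ ε := by
  have hlim := Real.tendsto_exp_neg_atTop_nhds_zero.const_mul A
  rw [mul_zero] at hlim
  obtain ⟨y, hy, hy0⟩ := ((hlim.eventually_lt_const hε).and (eventually_ge_atTop 0)).exists
  exact ⟨y, hy0, hy.le⟩

section Growth

variable {H : Type*} [Group H] [DecidableEq H] {S : Finset H}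

lemma exists_eventually_card_le_of_pairwiseDisjoint
    (hgrow : ∀ M : ℕ, ∃ r, 1 ≤ r ∧ M * r ≤ #(S ^ r)) {ε : ℝ} (hε : 0 < ε) :
    ∃ r : ℕ, ∀ᶠ T in invariantFilter S, ∀ Z : Finset H, Z ⊆ T →
      (Z : Set H).PairwiseDisjoint (fun z ↦ S ^ r <• z) → ((2 * r + 1) * #Z : ℝ) ≤ ε * #T := by
  obtain ⟨M, hM⟩ := exists_nat_ge (6 / ε)
  obtain ⟨r, hr, hMr⟩ := hgrow M
  refine ⟨r, ?_⟩
  filter_upwards [invariantFilter_le_pow S r (eventually_card_mul_card_le_two_mul (S ^ r))]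
    with T hT Z hZT hZ
  have hr : (1 : ℝ) ≤ r := mod_cast hr
  have hMr : (M * r : ℝ) ≤ #(S ^ r) := mod_cast hMr
  have hcard : (#(S ^ r) * #Z : ℝ) ≤ 2 * #T := mod_cast hT Z hZT hZ
  have hεM : 6 ≤ ε * M := (div_le_iff₀' hε).1 hM
  calc ((2 * r + 1) * #Z : ℝ) ≤ 3 * r * #Z := by gcongr; linarith
    _ = 6 * (r * #Z) / 2 := by ring
    _ ≤ ε * M * (r * #Z) / 2 := by gcongr
    _ = ε * ((M * r) * #Z) / 2 := by ring
    _ ≤ ε * (#(S ^ r) * #Z) / 2 := by gcongr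
    _ ≤ ε * (2 * #T) / 2 := by gcongr
    _ = ε * #T := by ring

lemma frequently_folner_of_forall_reach [(folner H).NeBot] {p : Finset H → Prop} (A : Finset H)
    (h : ∀ S, A ⊆ S →
      ∀ᶠ T in invariantFilter S, 1 ∈ T → (∀ t ∈ T, Reach S T 1 t) → p T) :
    ∃ᶠ T in folner H, p T := by
  intro hnot
  obtain ⟨K, hK⟩ := eventually_folner_iff.1 hnot
  let S := (A ∪ K) ∪ (A ∪ K)⁻¹
  have hS : S⁻¹ = S := by
    ext
    simp only [S, Finset.mem_inv', Finset.mem_union, inv_inv, or_comm]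
  have hAK : A ∪ K ⊆ S := Finset.subset_union_left
  have : (invariantFilter S).NeBot := NeBot.mono ‹_› (folner_le S)
  have hnp := hK.filter_mono (invariantFilter_anti (Finset.subset_union_right.trans hAK))
  obtain ⟨T, ⟨hT1, hT⟩, hpT, hnpT⟩ := ((frequently_invariantFilter_reach hS).and_eventually
    ((h S (Finset.subset_union_left.trans hAK)).and hnp)).exists
  exact hnpT (hpT hT1 hT)

end Growth

namespace OrbitCocycle

variable {G H X Y : Type*} [Group G] [TopologicalSpace X] [MulAction G X]
  [Group H] [TopologicalSpace Y] [MulAction H Y] {c : OrbitCocycle G H X Y}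

lemma IsPartialNet.log_minSubcover_le [DecidableEq G] [DecidableEq H] {𝒱 : Set (Set Y)}
    (h𝒱 : IsFiniteOpenCover 𝒱) {S S₂ T Z D : Finset H} {r : ℕ} {q y b : ℝ}
    (hnet : c.IsPartialNet S S₂ T r Z D) (hD : ∀ t ∈ T, ∃ d ∈ D, Reach S T d t)
    (hT : T ⊆ S ^ (2 * r) * (Z ∪ D))
    (hq₀ : 0 ≤ q) (hq : ∀ x, (#(edgeBoundary (c.lVals S) (c.shape T x)) : ℝ) ≤ q) (hy : 0 ≤ y)
    (hb₀ : 0 ≤ b)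
    (hb : ∀ x, Real.log (minSubcover (coverJoin (c.pullbackCover 𝒱 S) (c.shape T x))) ≤ b) :
    Real.log (minSubcover (coverJoin 𝒱 T)) ≤
      (2 * r + 1) * #Z * Real.log #(c.lVals S) +
        #D * (Real.log #(c.lVals S₂) + 2 * r * Real.log #(c.lVals S)) +
        q * y + #(c.lVals S) * #(c.lVals (S ^ (2 * r))) * Real.exp (-y) * #T + b := by
  have hlog := log_natCast_le_log_add (by positivity) (minSubcover_coverJoin_le h𝒱
    hnet.restrictionsLE hnet.right_subset hD Finset.subset_union_right hT hq hy hb)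
  have hN := log_natCast_le_of_le_mul (le_refl
    (#(c.lVals S) ^ ((2 * r + 1) * #Z) * (#(c.lVals S₂) * #(c.lVals S) ^ (2 * r)) ^ #D))
  have hjump := log_natCast_le_of_le_mul (le_refl (#(c.lVals S₂) * #(c.lVals S) ^ (2 * r)))
  have hZD : #(Z ∪ D) ≤ #T :=
    Finset.card_le_card (Finset.union_subset hnet.left_subset hnet.right_subset)
  have hcells : #(c.lVals S) * (#(c.lVals (S ^ (2 * r))) * #(Z ∪ D)) * Real.exp (-y) ≤
      #(c.lVals S) * #(c.lVals (S ^ (2 * r))) * Real.exp (-y) * #T := by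
    calc _ = #(c.lVals S) * #(c.lVals (S ^ (2 * r))) * Real.exp (-y) * #(Z ∪ D) := by ring
      _ ≤ _ := by gcongr
  rw [Nat.cast_pow, Nat.cast_pow, Real.log_pow, Real.log_pow] at hN
  rw [Nat.cast_pow, Real.log_pow] at hjump
  have hjumps := mul_le_mul_of_nonneg_left hjump (Nat.cast_nonneg (α := ℝ) #D)
  push_cast at hlog hN hjumps ⊢
  linarith

theorem frequently_log_minSubcover_le [DecidableEq H] (c : OrbitCocycle G H X Y)
    [(folner H).NeBot] (hH : ¬ IsLocallyVirtuallyCyclic H)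
    {F : ℕ → Finset G} (hF : IsFolnerSeq F) {a η : ℝ} (ha : 0 ≤ a) (haF : topEntropy X F < a)
    {𝒱 : Set (Set Y)} (h𝒱 : IsFiniteOpenCover 𝒱) (hη : 0 < η) :
    ∃ᶠ T in folner H, Real.log (minSubcover (coverJoin 𝒱 T)) ≤ (a + η) * #T := by
  classical
  obtain ⟨S, h1, hS, hgrow⟩ := exists_superlinear_growth hH
  have hgrow' (N : ℕ) : ∃ n, N ≤ #(S ^ n) :=
    (hgrow N).imp fun r hr ↦ (Nat.le_mul_of_pos_right N hr.1).trans hr.2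
  have hη₈ : 0 < η / 8 := by positivity
  have he : 0 ≤ Real.log #(c.lVals S) := Real.log_natCast_nonneg _
  obtain ⟨r, hr⟩ := exists_eventually_card_le_of_pairwiseDisjoint hgrow
    (div_pos hη₈ (by positivity : 0 < Real.log #(c.lVals S) + 1))
  obtain ⟨y, hy, hyη⟩ := exists_nonneg_mul_exp_neg_le
    (#(c.lVals S) * #(c.lVals (S ^ (2 * r)))) hη₈
  have hentropy := c.eventually_forall_shape (eventually_log_minSubcover_le_of_topEntropy_lt
    hF ha haF (isFiniteOpenCover_pullbackCover (c := c) h𝒱 S) (half_pos hη))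
  have hboundary := c.eventually_forall_shape (eventually_folner_isInvariant (c.lVals S)
    (div_pos hη₈ (by positivity : 0 < y + 1)))
  obtain ⟨K, hK⟩ := eventually_folner_iff.1 (hentropy.and hboundary)
  refine frequently_folner_of_forall_reach (S ∪ K) fun S₂ hSK ↦ ?_
  have hSS₂ : S ⊆ S₂ := Finset.subset_union_left.trans hSK
  have hC : 0 ≤ Real.log #(c.lVals S₂) + 2 * r * Real.log #(c.lVals S) := by
    have := Real.log_natCast_nonneg #(c.lVals S₂)
    positivity
  filter_upwards [hr.filter_mono (invariantFilter_anti hSS₂),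
    (eventually_card_le_of_pairwise_not_reach h1 hS hgrow'
      (div_pos hη₈ (add_pos_of_nonneg_of_pos hC one_pos))).filter_mono (invariantFilter_anti hSS₂),
    hK.filter_mono (invariantFilter_anti (Finset.subset_union_right.trans hSK))]
    with T hZ hD hT h1T hreach
  simp only [IsInvariant, card_shape] at hT
  obtain ⟨Z, D, hnet, hDT, hTZD⟩ := c.exists_isPartialNet_spanning h1 hS ⟨1, hSS₂ h1⟩ h1T hreach r
  have hlog := hnet.log_minSubcover_le h𝒱 hDT hTZD (by positivity) hT.2 hy (by positivity) hT.1
  have hZcost := mul_le_mul_of_le_div_add_one he hη₈.le (Nat.cast_nonneg _)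
    (hZ Z hnet.left_subset hnet.pairwiseDisjoint)
  have hDcost := mul_le_mul_of_le_div_add_one hC hη₈.le (Nat.cast_nonneg _)
    (hD D hnet.right_subset hnet.pairwise_not_reach)
  have hboundary_cost := mul_le_mul_of_le_div_add_one hy hη₈.le (Nat.cast_nonneg #T) le_rfl
  have hcells_cost := mul_le_mul_of_nonneg_right hyη (Nat.cast_nonneg (α := ℝ) #T)
  linarith

theorem topEntropy_le (c : OrbitCocycle G H X Y) (hH : ¬ IsLocallyVirtuallyCyclic H)
    {F : ℕ → Finset G} (hF : IsFolnerSeq F) {E : ℕ → Finset H} (hE : IsFolnerSeq E) :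
    topEntropy Y E ≤ topEntropy X F := by
  classical
  have := hE.neBot_folner
  refine EReal.le_of_forall_lt_iff_le.1 fun a haF ↦ ?_
  have ha : 0 ≤ a := EReal.coe_nonneg.1 ((topEntropy_nonneg F).trans haF.le)
  exact topEntropy_le_of_frequently hE ha fun 𝒱 h𝒱 η hη ↦
    c.frequently_log_minSubcover_le hH hF ha haF h𝒱 hη

end OrbitCocycle

end OrbitEntropy

theorem mainTheorem7_general
    {G H X Y : Type*}
    [Group G] [TopologicalSpace G] [DiscreteTopology G]
    [Group H] [TopologicalSpace H] [DiscreteTopology H]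
    [TopologicalSpace X] [CompactSpace X] [TopologicalSpace Y]
    [MulAction G X] [ContinuousConstSMul G X] [MulAction H Y] [ContinuousConstSMul H Y]
    (hGc : ¬ OrbitEntropy.IsLocallyVirtuallyCyclic G)
    (hHc : ¬ OrbitEntropy.IsLocallyVirtuallyCyclic H)
    (hX : OrbitEntropy.IsTopologicallyFree G X)
    (hY : OrbitEntropy.IsTopologicallyFree H Y)
    (hcoe : OrbitEntropy.ContinuouslyOrbitEquivalent G X H Y)
    (F : ℕ → Finset G) (hF : OrbitEntropy.IsFolnerSeq F)
    (E : ℕ → Finset H) (hE : OrbitEntropy.IsFolnerSeq E) :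
    OrbitEntropy.topEntropy X F = OrbitEntropy.topEntropy Y E := by
  have : CompactSpace Y := hcoe.elim fun Φ _ ↦ Φ.compactSpace
  obtain ⟨c⟩ := hcoe.nonempty_orbitCocycle hX hY
  obtain ⟨c'⟩ := hcoe.symm.nonempty_orbitCocycle hY hX
  exact le_antisymm (c'.topEntropy_le hGc hE hF) (c.topEntropy_le hHc hF hE)

theorem mainTheorem7
    {G H X Y : Type*}
    [Group G] [TopologicalSpace G] [DiscreteTopology G] [Countable G] [Infinite G]
    [Group H] [TopologicalSpace H] [DiscreteTopology H] [Countable H] [Infinite H]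
    [TopologicalSpace X] [CompactSpace X] [TopologicalSpace.MetrizableSpace X]
    [TopologicalSpace Y] [CompactSpace Y] [TopologicalSpace.MetrizableSpace Y]
    [MulAction G X] [ContinuousSMul G X] [MulAction H Y] [ContinuousSMul H Y]
    (hGa : OrbitEntropy.IsAmenable G) (hHa : OrbitEntropy.IsAmenable H)
    (hGc : ¬ OrbitEntropy.IsLocallyVirtuallyCyclic G)
    (hHc : ¬ OrbitEntropy.IsLocallyVirtuallyCyclic H)
    (hX : OrbitEntropy.IsTopologicallyFree G X)
    (hY : OrbitEntropy.IsTopologicallyFree H Y)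
    (hcoe : OrbitEntropy.ContinuouslyOrbitEquivalent G X H Y)
    (F : ℕ → Finset G) (hF : OrbitEntropy.IsFolnerSeq F)
    (E : ℕ → Finset H) (hE : OrbitEntropy.IsFolnerSeq E) :
    OrbitEntropy.topEntropy X F = OrbitEntropy.topEntropy Y E :=
  mainTheorem7_general hGc hHc hX hY hcoe F hF E hE
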